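/- **Model.** Let $(\Omega,\mathcal F,\mathrm P)$ be a probability space with a filtration $(\mathcal F_t)_{t\ge 0}$, and consider $M\ge 2$ investors and $N\ge 1$ assets. For $t\ge1$ let $X_t=(X_t^1,\dots,X_t^N)\in\mathbb R_+^N$ be $\mathcal F_t$-measurable payoffs and $\rho_t\ge 0$ an $\mathcal F_{t-1}$-measurable gross return on a bank account, with $\rho_t+\sum_nX_t^n>0$ a.s. Write $|x|=\sum_n|x^n|$. Let $\Delta=\{\lambda\in\mathbb R_+^{MN}:\sum_n\lambda^{m,n}\le 1\text{ for each }m\}$. A strategy $\Lambda$ is a sequence of $\mathcal F_{t-1}\otimes\mathcal B(\mathbb R_+^M\times\Delta^{t-1})$-measurable functions $\Lambda_t(\omega,y_0,\lambda_1,\dots,\lambda_{t-1})$, $t\ge1$, with values in $\{v\in\mathbb R_+^N: |v|\le1\}$. Given a vector of initial capital $Y_0=(Y_0^1,\dots,Y_0^M)$ with all $Y_0^m>0$ (non-random) and strategies $\Lambda^1,\dots,\Lambda^M$, the realized proportions are $\lambda_t^m=\Lambda^m_t(\omega,Y_0,\lambda_1,\dots,\lambda_{t-1})$ and the wealth of investor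 $m$ satisfies $$Y_t^m=\rho_t\Bigl(1-\sum_n\lambda_t^{m,n}\Bigr)Y_{t-1}^m+\sum_n\frac{\lambda_t^{m,n}Y_{t-1}^m}{\sum_k\lambda_t^{k,n}Y_{t-1}^k}X_t^n,\qquad t\ge1\quad(0/0=0).$$ Let $r_t^m=Y_t^m/\sum_kY_t^k$ ($0/0=0$). A strategy of investor $m$ is called relative growth optimal if $\ln r_t^m$ is a submartingale for every vector of positive initial capital and all strategies of the other investors. **The strategy $\hat\Lambda$.** Let $K_t(\omega,dx)$ be a regular conditional distribution of $X_t$ with respect to $\mathcal F_{t-1}$. If $\int \frac{c\rho_t}{|x|}K_t(dx)>1$ (with $0/0=0$ and $a/0=+\infty$ for $a>0$), let $\zeta_t(c)$ be the unique $z\in(0,c]$ with $\int\frac{c\rho_t}{z\rho_t+|x|}K_t(dx)=1$; otherwise let $\zeta_t(c)=0$. Then $$\hat\Lambda_t^n(\omega,y_0,\lambda_1,\dots,\lambda_{t-1})=\int\frac{x^n}{\zeta_t(\omega,C_{t-1})\,\rho_t(\omega)+|x|}K_t(\omega,dx)\qquad(0/0=0),$$ where $C_{t-1}$ is the total wealth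 $\sum_mY_{t-1}^m$ computed by the wealth equation from the history $(y_0,\lambda_1,\dots,\lambda_{t-1})$. **Theorem.** Suppose investor 1 uses $\hat\Lambda$ (or any other relative growth optimal strategy) and the other investors use arbitrary strategies. Then for any vector of positive initial capital $Y_0$ the following holds, with $\ln 0=-\infty$. 1) For every $m$, $\displaystyle\limsup_{t\to\infty}\tfrac1t\ln Y_t^1\ \ge\ \limsup_{t\to\infty}\tfrac1t\ln Y_t^m$ a.s. 2) If $M=2$ and $\mathrm E|X_t|<\infty$ for all $t\ge1$, then for all $s,t\ge0$ $$\mathrm E\Bigl(\ln\frac{Y_{s+t}^1}{Y_s^1}\Bigm|\mathcal F_s\Bigr)\ \ge\ \mathrm E\Bigl(\ln\frac{Y_{s+t}^2}{Y_s^2}\Bigm|\mathcal F_s\Bigr)\quad\text{a.s.},$$ where $\ln\frac00=-\infty$ and $\mathrm E(\xi\mid\mathcal F_s)=\mathrm E(\xi^+\mid\mathcal F_s)-\mathrm E(\xi^-\mid\mathcal F_s)\in[-\infty,\infty]$, read as $-\infty$ at points where both terms are infinite. If moreover $\mathrm E\ln^+\rho_t<\infty$ for all $t\ge1$, then $\mathrm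 E(\ln^+(Y^m_{s+t}/Y^m_s)\mid\mathcal F_s)<\infty$ a.s. for $m=1,2$ and all $s,t\ge0$, so that both sides are well defined. -/

import Mathlib

open MeasureTheory ProbabilityTheory Filter
open scoped NNReal ENNReal

/-- Vectors of investment proportions of one investor: `v n ≥ 0` and `∑ n, v n ≤ 1`.  The
remaining proportion `1 - ∑ n, v n` is kept in the bank account. -/
abbrev Proportions (N : ℕ) : Type := {v : Fin N → ℝ≥0 // ∑ n, v n ≤ 1}

/-- The set `Δ` of joint investment proportions of the `M` investors. -/
abbrev JointProportions (M N : ℕ) : Type := Fin M → Proportions N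

/-- The exogenous data of the market.  `X t ω n` is the payoff of asset `n` at time `t` and
`ρ t ω` is the gross return on the bank account from time `t - 1` to time `t`, both for `t ≥ 1`
(the values at `t = 0` are never used).  Payoffs are adapted, `ρ` is predictable. -/
structure Market {Ω : Type*} [mΩ : MeasurableSpace Ω] (P : Measure Ω) (F : Filtration ℕ mΩ)
    (N : ℕ) where
  X : ℕ → Ω → Fin N → ℝ≥0
  ρ : ℕ → Ω → ℝ≥0
  adapted_X : ∀ t, Measurable[F (t + 1)] (X (t + 1))
  predictable_ρ : ∀ t, Measurable[F t] (ρ (t + 1))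
  pos : ∀ t, ∀ᵐ ω ∂P, 0 < ρ (t + 1) ω + ∑ n, X (t + 1) ω n

/-- A rule of behaviour of one investor: `Λ t ω y₀ (λ₁, …, λ_t)` is the vector of investment
proportions `λ_{t+1}` chosen at time `t`, given the initial capitals `y₀` and the past joint
proportions.  The `s`-th entry of the history (`s : Fin t`) is `λ_{s+1}`. -/
abbrev Rule (Ω : Type*) (M N : ℕ) : Type _ :=
  (t : ℕ) → Ω → (Fin M → ℝ≥0) → (Fin t → JointProportions M N) → Proportions N

/-- A strategy is a rule such that the choice made at time `t` is jointly measurable with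
respect to `F_t ⊗ Borel`. -/
def IsStrategy {Ω : Type*} [mΩ : MeasurableSpace Ω] (F : Filtration ℕ mΩ) {M N : ℕ}
    (Λ : Rule Ω M N) : Prop :=
  ∀ t, Measurable[(F t).prod
      (inferInstance : MeasurableSpace ((Fin M → ℝ≥0) × (Fin t → JointProportions M N)))]
    (fun p : Ω × ((Fin M → ℝ≥0) × (Fin t → JointProportions M N)) => Λ t p.1 p.2.1 p.2.2)

/-- One step of the wealth equation: from the wealth vector `y`, with joint proportions `l`,
gross bank return `ρ` and payoffs `x`.  Division is that of `ℝ≥0`, so `0 / 0 = 0`; the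
subtraction does not truncate because `∑ n, l m n ≤ 1`. -/
noncomputable def wealthStep {M N : ℕ} (ρ : ℝ≥0) (x : Fin N → ℝ≥0) (l : JointProportions M N)
    (y : Fin M → ℝ≥0) (m : Fin M) : ℝ≥0 :=
  ρ * (1 - ∑ n, (l m).1 n) * y m
    + ∑ n, (l m).1 n * y m / (∑ k, (l k).1 n * y k) * x n

namespace Market

variable {Ω : Type*} [mΩ : MeasurableSpace Ω] {P : Measure Ω} {F : Filtration ℕ mΩ} {M N : ℕ}

/-- The wealth vector at time `t` as a function of the history `(y₀, λ₁, …, λ_t)`. -/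
noncomputable def wealthOfHistory (S : Market P F N) (ω : Ω) (y₀ : Fin M → ℝ≥0) :
    (t : ℕ) → (Fin t → JointProportions M N) → Fin M → ℝ≥0
  | 0, _ => y₀
  | t + 1, h => wealthStep (S.ρ (t + 1) ω) (S.X (t + 1) ω) (h (Fin.last t))
      (wealthOfHistory S ω y₀ t (fun s => h s.castSucc))

/-- `K t ω` (for `t ≥ 1`) is a regular conditional distribution of the payoff vector `X_t` with
respect to `F_{t-1}`. -/
structure IsRegularConditionalLaw (S : Market P F N)
    (K : ℕ → Ω → ProbabilityMeasure (Fin N → ℝ≥0)) : Prop where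
  measurable : ∀ t, ∀ A : Set (Fin N → ℝ≥0), MeasurableSet A →
    Measurable[F t] (fun ω => (K (t + 1) ω : Measure (Fin N → ℝ≥0)) A)
  condProb : ∀ t, ∀ A : Set (Fin N → ℝ≥0), MeasurableSet A →
    (fun ω => (K (t + 1) ω : Measure (Fin N → ℝ≥0)).real A)
      =ᵐ[P] P[(S.X (t + 1) ⁻¹' A).indicator (fun _ => (1 : ℝ)) | F t]

end Market

/-- The condition `∫ c ρ / |x| K(dx) > 1`.  In `ℝ≥0∞` one has `0 / 0 = 0` and `a / 0 = ∞` for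
`a > 0`. -/
def InGamma {N : ℕ} (ρ : ℝ≥0) (κ : ProbabilityMeasure (Fin N → ℝ≥0)) (c : ℝ≥0) : Prop :=
  1 < ∫⁻ x, ((c * ρ : ℝ≥0) : ℝ≥0∞) / ((∑ n, x n : ℝ≥0) : ℝ≥0∞) ∂(κ : Measure (Fin N → ℝ≥0))

/-- `z ∈ (0, c]` solves `∫ c ρ / (z ρ + |x|) K(dx) = 1`. -/
def SolvesZeta {N : ℕ} (ρ : ℝ≥0) (κ : ProbabilityMeasure (Fin N → ℝ≥0)) (c z : ℝ≥0) : Prop :=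
  0 < z ∧ z ≤ c ∧
    ∫⁻ x, ((c * ρ : ℝ≥0) : ℝ≥0∞) / ((z * ρ + ∑ n, x n : ℝ≥0) : ℝ≥0∞)
      ∂(κ : Measure (Fin N → ℝ≥0)) = 1

open Classical in
/-- The function `ζ`: the (unique) solution `z ∈ (0, c]` of `∫ c ρ / (z ρ + |x|) K(dx) = 1` if
`∫ c ρ / |x| K(dx) > 1`, and zero otherwise. -/
noncomputable def zeta {N : ℕ} (ρ : ℝ≥0) (κ : ProbabilityMeasure (Fin N → ℝ≥0)) (c : ℝ≥0) :
    ℝ≥0 :=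
  if h : InGamma ρ κ c ∧ ∃ z, SolvesZeta ρ κ c z then h.2.choose else 0

/-- The proportion `∫ xⁿ / (z ρ + |x|) K(dx)`, where `0 / 0 = 0` and `a = z ρ`. -/
noncomputable def hatProportion {N : ℕ} (a : ℝ≥0) (κ : ProbabilityMeasure (Fin N → ℝ≥0))
    (n : Fin N) : ℝ≥0 :=
  (∫⁻ x, (x n : ℝ≥0∞) / ((a + ∑ k, x k : ℝ≥0) : ℝ≥0∞) ∂(κ : Measure (Fin N → ℝ≥0))).toNNReal

theorem sum_hatProportion_le_one {N : ℕ} (a : ℝ≥0) (κ : ProbabilityMeasure (Fin N → ℝ≥0)) :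
    ∑ n, hatProportion a κ n ≤ 1 := by
  have hmeas : ∀ n : Fin N, Measurable (fun x : Fin N → ℝ≥0 =>
      (x n : ℝ≥0∞) / ((a + ∑ k, x k : ℝ≥0) : ℝ≥0∞)) := by
    intro n
    fun_prop
  have hsum : ∑ n, ∫⁻ x, (x n : ℝ≥0∞) / ((a + ∑ k, x k : ℝ≥0) : ℝ≥0∞)
      ∂(κ : Measure (Fin N → ℝ≥0)) ≤ 1 := by
    rw [← lintegral_finsetSum _ (fun n _ => hmeas n)]
    calc ∫⁻ x, ∑ n, (x n : ℝ≥0∞) / ((a + ∑ k, x k : ℝ≥0) : ℝ≥0∞)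
          ∂(κ : Measure (Fin N → ℝ≥0))
        ≤ ∫⁻ _, 1 ∂(κ : Measure (Fin N → ℝ≥0)) := by
          refine lintegral_mono fun x => ?_
          simp only [div_eq_mul_inv]
          rw [← Finset.sum_mul, ← div_eq_mul_inv]
          refine ENNReal.div_le_of_le_mul ?_
          rw [one_mul]
          push_cast
          exact le_add_self
      _ = 1 := by simp
  have hfin : ∀ n ∈ Finset.univ, ∫⁻ x, (x n : ℝ≥0∞) / ((a + ∑ k, x k : ℝ≥0) : ℝ≥0∞)
      ∂(κ : Measure (Fin N → ℝ≥0)) ≠ ∞ := fun n hn =>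
    ne_top_of_le_ne_top ENNReal.one_ne_top
      ((Finset.single_le_sum (fun i _ => zero_le (a := _)) hn).trans hsum)
  unfold hatProportion
  rw [← ENNReal.toNNReal_sum hfin]
  exact ENNReal.toNNReal_mono ENNReal.one_ne_top hsum

namespace Market

variable {Ω : Type*} [mΩ : MeasurableSpace Ω] {P : Measure Ω} {F : Filtration ℕ mΩ} {M N : ℕ}

/-- The strategy `Λ̂`: with `C` the total wealth at time `t` computed from the history, the
proportion `λ_{t+1}` invested in asset `n` is `∫ xⁿ / (ζ_{t+1}(C) ρ_{t+1} + |x|) K_{t+1}(dx)`. -/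
noncomputable def hatRule (S : Market P F N)
    (K : ℕ → Ω → ProbabilityMeasure (Fin N → ℝ≥0)) : Rule Ω M N :=
  fun t ω y₀ h =>
    let C : ℝ≥0 := ∑ m, S.wealthOfHistory ω y₀ t h m
    let a : ℝ≥0 := zeta (S.ρ (t + 1) ω) (K (t + 1) ω) C * S.ρ (t + 1) ω
    ⟨hatProportion a (K (t + 1) ω), sum_hatProportion_le_one a (K (t + 1) ω)⟩

end Market

/-- The realized joint proportions `(λ₁(ω), …, λ_t(ω))` when the investors use the profile `L`
and have initial capitals `y₀`. -/
def realization {Ω : Type*} {M N : ℕ} (L : Fin M → Rule Ω M N) (y₀ : Fin M → ℝ≥0) (ω : Ω) :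
    (t : ℕ) → Fin t → JointProportions M N
  | 0 => Fin.elim0
  | t + 1 => Fin.snoc (α := fun _ => JointProportions M N) (realization L y₀ ω t)
      (fun m => L m t ω y₀ (realization L y₀ ω t))

namespace Market

variable {Ω : Type*} [mΩ : MeasurableSpace Ω] {P : Measure Ω} {F : Filtration ℕ mΩ} {M N : ℕ}

/-- The wealth `Y_t^m(ω)` of investor `m` at time `t`. -/
noncomputable def wealth (S : Market P F N) (L : Fin M → Rule Ω M N) (y₀ : Fin M → ℝ≥0)
    (t : ℕ) (m : Fin M) (ω : Ω) : ℝ≥0 :=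
  S.wealthOfHistory ω y₀ t (realization L y₀ ω t) m

/-- The relative wealth `r_t^m = Y_t^m / ∑ k, Y_t^k`, equal to zero if the total wealth is. -/
noncomputable def relWealth (S : Market P F N) (L : Fin M → Rule Ω M N) (y₀ : Fin M → ℝ≥0)
    (t : ℕ) (m : Fin M) (ω : Ω) : ℝ≥0 :=
  S.wealth L y₀ t m ω / ∑ k, S.wealth L y₀ t k ω

/-- A strategy `Λ` of investor `i` is relative growth optimal if, for all positive initial
capitals and all strategies of the other investors, `ln r_t^i` is a submartingale.  As
`ln 0 = -∞`, integrability of `ln r_t^i` includes `r_t^i > 0` a.s., which is stated separately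
because of the convention `Real.log 0 = 0`. -/
def IsRelativeGrowthOptimal (S : Market P F N) (i : Fin M) (Λ : Rule Ω M N) : Prop :=
  IsStrategy F Λ ∧
    ∀ (y₀ : Fin M → ℝ≥0) (L : Fin M → Rule Ω M N), (∀ m, 0 < y₀ m) → L i = Λ →
      (∀ m, m ≠ i → IsStrategy F (L m)) →
        (∀ t, ∀ᵐ ω ∂P, 0 < S.relWealth L y₀ t i ω) ∧
          Submartingale (fun t ω => Real.log (S.relWealth L y₀ t i ω)) F P

/-- `ln (Y_{s+t}^m / Y_s^m)` with values in `[-∞, ∞]`, where `ln 0 = -∞` and `ln (0 / 0) = -∞`.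
(If `Y_s^m = 0` then `Y_{s+t}^m = 0`.) -/
noncomputable def logReturn (S : Market P F N) (L : Fin M → Rule Ω M N) (y₀ : Fin M → ℝ≥0)
    (s t : ℕ) (m : Fin M) (ω : Ω) : EReal :=
  ENNReal.log ((S.wealth L y₀ (s + t) m ω / S.wealth L y₀ s m ω : ℝ≥0) : ℝ≥0∞)

end Market

/-- The generalized conditional expectation `E(f⁺ | m) - E(f⁻ | m)` of an extended real random
variable.  It is meaningful where at least one of the two terms is finite; where both are infinite
its value is `-∞`, by the convention `⊤ - ⊤ = ⊥` of `EReal`. -/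
noncomputable def extCondExp {Ω : Type*} [mΩ : MeasurableSpace Ω] (P : Measure Ω)
    (m : MeasurableSpace Ω) (f : Ω → EReal) (ω : Ω) : EReal :=
  (condLExp m P (fun ω' => (f ω').toENNReal) ω : EReal)
    - (condLExp m P (fun ω' => (-f ω').toENNReal) ω : EReal)

/-!
Let investor `i` use `Λ̂` and write `C` for the total wealth, `q n` for the proportion that this
investor puts into asset `n` divided by the proportion that the whole market puts there, and
`W = ζ ρ + |x|`.  The defining properties of `ζ` keep at least `ζ / C` of the wealth of investor
`i` in the bank, so the wealth of `i` is multiplied by at least `A / C` with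
`A = ζ ρ + ∑ q n x n`, and the relative wealth by at least `A / C'`, where `C'` is the new total
wealth.  By Cauchy–Schwarz `W ^ 2 ≤ A V` with `V = ζ ρ + ∑ x n / q n`, and `ln z ≥ 1 - 1 / z`,
applied to `W / C'` and `A / W`, shows that `ln r` grows by at least `1 - U` for a random variable
`U` of conditional mean at most one.  Hence `ln r` is a submartingale.

A nonpositive submartingale converges almost surely, so `C ≤ b Y^i` for a random constant `b`, and
`Y^m ≤ C` gives the comparison of the asymptotic growth rates.  For two investors, concavity of
the logarithm yields `ln (q' / q) + (p + q) / q * (ln r' - ln r) ≤ ln (p' / p)` for the wealths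
`p`, `q` of the optimal investor and of the other one and for `r = p / (p + q)`; the factor
`(p + q) / q` is known at the initial time and `ln r' - ln r` has nonnegative conditional mean.
-/

section Conditioning

variable {Ω : Type*} {m mΩ : MeasurableSpace Ω} {P : Measure Ω}

theorem lintegral_mul_condLExp (hm : m ≤ mΩ) [SigmaFinite (P.trim hm)] {g f : Ω → ℝ≥0∞}
    (hg : Measurable[m] g) (hf : Measurable f) :
    ∫⁻ ω, g ω * P⁻[f | m] ω ∂P = ∫⁻ ω, g ω * f ω ∂P := by
  have hg' : Measurable g := hg.mono hm le_rfl
  have htrim : (P.withDensity P⁻[f | m]).trim hm = (P.withDensity f).trim hm := by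
    refine @Measure.ext _ m _ _ fun A hA => ?_
    rw [trim_measurableSet_eq hm hA, trim_measurableSet_eq hm hA, withDensity_apply _ (hm A hA),
      withDensity_apply _ (hm A hA), setLIntegral_condLExp _ P f hA]
  simp only [mul_comm (g _)]
  calc ∫⁻ ω, P⁻[f | m] ω * g ω ∂P = ∫⁻ ω, g ω ∂P.withDensity P⁻[f | m] :=
        (lintegral_withDensity_eq_lintegral_mul _ (measurable_condLExp' m P f) hg').symm
    _ = ∫⁻ ω, g ω ∂P.withDensity f := by
        rw [← lintegral_trim hm hg, htrim, lintegral_trim hm hg]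
    _ = ∫⁻ ω, f ω * g ω ∂P := lintegral_withDensity_eq_lintegral_mul _ hf hg'

theorem condLExp_mul_of_measurable_left (hm : m ≤ mΩ) [SigmaFinite (P.trim hm)]
    {g f : Ω → ℝ≥0∞} (hg : Measurable[m] g) (hf : Measurable f) :
    P⁻[fun ω => g ω * f ω | m] =ᵐ[P] fun ω => g ω * P⁻[f | m] ω := by
  refine (ae_eq_condLExp hm P _ (hg.fun_mul (measurable_condLExp m P f)) fun s hs => ?_).symm
  rw [← lintegral_indicator (hm s hs), ← lintegral_indicator (hm s hs)]
  simp only [Set.indicator_mul_left]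
  exact lintegral_mul_condLExp (P := P) hm (Measurable.indicator hg hs) hf

theorem measurable_lintegral_of_forall_measurable {T E : Type*} [MeasurableSpace T]
    [MeasurableSpace E] {κ : T → ProbabilityMeasure E}
    (hκ : ∀ A, MeasurableSet A → Measurable fun τ => (κ τ : Measure E) A)
    {f : T × E → ℝ≥0∞} (hf : Measurable f) :
    Measurable fun τ => ∫⁻ x, f (τ, x) ∂(κ τ : Measure E) := by
  let κ' : Kernel T E := ⟨fun τ => κ τ, Measure.measurable_of_measurable_coe _ hκ⟩
  have : IsMarkovKernel κ' := ⟨fun τ => inferInstanceAs (IsProbabilityMeasure (κ τ : Measure E))⟩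
  exact hf.lintegral_kernel_prod_right' (κ := κ')

theorem condLExp_ae_eq_lintegral_of_condLaw (hm : m ≤ mΩ) [IsFiniteMeasure P] {E : Type*}
    [MeasurableSpace E] {X : Ω → E} (hX : Measurable X) {κ : Ω → ProbabilityMeasure E}
    (hκ : ∀ A, MeasurableSet A → Measurable[m] fun ω => (κ ω : Measure E) A)
    (hκX : ∀ A, MeasurableSet A →
      P⁻[(X ⁻¹' A).indicator 1 | m] =ᵐ[P] fun ω => (κ ω : Measure E) A)
    {f : Ω × E → ℝ≥0∞} (hf : Measurable[m.prod inferInstance] f) :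
    P⁻[fun ω => f (ω, X ω) | m] =ᵐ[P] fun ω => ∫⁻ x, f (ω, x) ∂(κ ω : Measure E) := by
  let κ' : @Kernel Ω E m _ :=
    @Kernel.mk _ _ m _ (fun ω => κ ω) (@Measure.measurable_of_measurable_coe _ _ _ m _ hκ)
  have : @IsMarkovKernel _ _ m _ κ' :=
    @IsMarkovKernel.mk _ _ m _ _ fun ω => inferInstanceAs (IsProbabilityMeasure (κ ω : Measure E))
  have hφ : Measurable[mΩ, m.prod inferInstance] fun ω => (ω, X ω) :=
    @Measurable.prodMk _ mΩ _ _ m _ id _ (measurable_id'' hm) hX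
  have hlaw : @Measure.map _ _ mΩ (m.prod inferInstance) (fun ω => (ω, X ω)) P
      = @Measure.compProd _ _ m _ (P.trim hm) κ' := by
    refine @Measure.ext_prod _ _ m _ _ _ _ fun {A B} hA hB => ?_
    rw [@Measure.map_apply _ _ _ (m.prod inferInstance) _ _ hφ _ (hA.prod hB),
      Measure.compProd_apply_prod hA hB,
      setLIntegral_trim (f := fun ω => κ' ω B) hm (hκ B hB) hA]
    calc P (A ∩ X ⁻¹' B) = ∫⁻ ω in A, (X ⁻¹' B).indicator 1 ω ∂P := by
          rw [lintegral_indicator_one (hX hB), Measure.restrict_apply (hX hB), Set.inter_comm]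
      _ = ∫⁻ ω in A, P⁻[(X ⁻¹' B).indicator 1 | m] ω ∂P := (setLIntegral_condLExp hm P _ hA).symm
      _ = ∫⁻ ω in A, κ' ω B ∂P := lintegral_congr_ae (ae_restrict_of_ae (hκX B hB))
  have hfκ : Measurable[m] fun ω => ∫⁻ x, f (ω, x) ∂κ' ω :=
    @measurable_lintegral_of_forall_measurable _ _ m _ κ hκ f hf
  refine (ae_eq_condLExp hm P _ hfκ fun A hA => ?_).symm
  calc ∫⁻ ω in A, ∫⁻ x, f (ω, x) ∂κ' ω ∂P
      = ∫⁻ p in A ×ˢ Set.univ, f p ∂(@Measure.compProd _ _ m _ (P.trim hm) κ') := by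
        rw [Measure.setLIntegral_compProd hf hA .univ, setLIntegral_trim hm (by simpa) hA]
        simp only [Measure.restrict_univ]
    _ = ∫⁻ ω in A, f (ω, X ω) ∂P := by
        rw [← hlaw, @setLIntegral_map _ _ mΩ (m.prod inferInstance) _ _ _ _
          (hA.prod .univ) hf hφ]
        simp only [Set.mk_preimage_prod, Set.preimage_univ, Set.inter_univ, Set.preimage_id']

theorem ae_eq_zero_of_condLExp_eq_zero (hm : m ≤ mΩ) [SigmaFinite (P.trim hm)] {f : Ω → ℝ≥0∞}
    (hf : Measurable f) : ∀ᵐ ω ∂P, P⁻[f | m] ω = 0 → f ω = 0 := by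
  have hA : MeasurableSet[m] {ω | P⁻[f | m] ω = 0} :=
    measurable_condLExp m P f (measurableSet_singleton 0)
  have h_zero : ∫⁻ ω in {ω | P⁻[f | m] ω = 0}, f ω ∂P = 0 := by
    rw [← setLIntegral_condLExp hm P f hA, setLIntegral_congr_fun (hm _ hA) fun _ h => h,
      lintegral_zero]
  exact (ae_restrict_iff' (hm _ hA)).1 ((lintegral_eq_zero_iff hf).1 h_zero)

theorem lintegral_ne_top_of_condLExp_le_one [IsFiniteMeasure P] (hm : m ≤ mΩ) {U : Ω → ℝ≥0∞}
    (hU_le : P⁻[U | m] ≤ᵐ[P] 1) : ∫⁻ ω, U ω ∂P ≠ ∞ := by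
  rw [← lintegral_condLExp (hm := hm)]
  exact ne_top_of_le_ne_top (measure_ne_top P Set.univ)
    ((lintegral_mono_ae hU_le).trans_eq lintegral_one)

theorem integrable_of_condLExp_le_one [IsFiniteMeasure P] (hm : m ≤ mΩ) {U : Ω → ℝ≥0}
    (hU : Measurable U) (hU_le : P⁻[fun ω => (U ω : ℝ≥0∞) | m] ≤ᵐ[P] 1) :
    Integrable (fun ω => (U ω : ℝ)) P := by
  simpa using integrable_toReal_of_lintegral_ne_top
    (measurable_coe_nnreal_ennreal.comp hU).aemeasurable
    (lintegral_ne_top_of_condLExp_le_one hm hU_le)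

theorem condExp_one_sub_nonneg [IsFiniteMeasure P] (hm : m ≤ mΩ) {U : Ω → ℝ≥0}
    (hU : Measurable U) (hU_le : P⁻[fun ω => (U ω : ℝ≥0∞) | m] ≤ᵐ[P] 1) :
    0 ≤ᵐ[P] P[fun ω => 1 - (U ω : ℝ) | m] := by
  have h_toReal : (fun ω => (P⁻[fun ω => (U ω : ℝ≥0∞) | m] ω).toReal)
      =ᵐ[P] P[fun ω => (U ω : ℝ) | m] :=
    toReal_condLExp m (measurable_coe_nnreal_ennreal.comp hU).aemeasurable
      (lintegral_ne_top_of_condLExp_le_one hm hU_le)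
  filter_upwards [condExp_sub (integrable_const (1 : ℝ))
    (integrable_of_condLExp_le_one hm hU hU_le) m, hU_le, h_toReal] with ω h_sub h_le h_eq
  calc (0 : ℝ) ≤ 1 - (P⁻[fun ω => (U ω : ℝ≥0∞) | m] ω).toReal :=
        sub_nonneg.2 (ENNReal.toReal_le_of_le_ofReal zero_le_one (by simpa using h_le))
    _ = P[fun ω => 1 - (U ω : ℝ) | m] ω := by
        rw [condExp_const hm] at h_sub
        rw [h_eq]
        exact h_sub.symm

variable {F : Filtration ℕ mΩ}

theorem submartingale_of_add_le [IsFiniteMeasure P] {f v : ℕ → Ω → ℝ}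
    (hf : StronglyAdapted F f) (hf_nonpos : ∀ t, f t ≤ᵐ[P] 0) (hf_zero : Integrable (f 0) P)
    (hv_int : ∀ t, Integrable (v t) P) (hv : ∀ t, 0 ≤ᵐ[P] P[v t | F t])
    (hstep : ∀ t, f t + v t ≤ᵐ[P] f (t + 1)) : Submartingale f F P := by
  have hf_int : ∀ t, Integrable (f t) P := by
    intro t
    induction t with
    | zero => exact hf_zero
    | succ t ih =>
      refine ((ih.add (hv_int t)).abs).mono'
        ((hf (t + 1)).mono (F.le _)).aestronglyMeasurable ?_
      filter_upwards [hstep t, hf_nonpos (t + 1)] with ω hω hω'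
      rw [Real.norm_eq_abs]
      exact abs_le_abs_of_nonpos hω' hω
  refine submartingale_of_condExp_sub_nonneg_nat hf hf_int fun t => ?_
  refine (hv t).trans (condExp_mono (hv_int t) ((hf_int (t + 1)).sub (hf_int t)) ?_)
  filter_upwards [hstep t] with ω hω
  exact le_sub_iff_add_le'.2 hω

theorem ae_exists_tendsto_of_submartingale_nonpos [IsFiniteMeasure P] {f : ℕ → Ω → ℝ}
    (hf : Submartingale f F P) (hf_nonpos : ∀ t, f t ≤ᵐ[P] 0) :
    ∀ᵐ ω ∂P, ∃ c, Tendsto (fun t => f t ω) atTop (nhds c) := by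
  refine hf.exists_ae_tendsto_of_bdd (R := (-∫ ω, f 0 ω ∂P).toNNReal) fun t => ?_
  have h_eLpNorm : eLpNorm (f t) 1 P = ENNReal.ofReal (-∫ ω, f t ω ∂P) := by
    rw [eLpNorm_one_eq_lintegral_enorm, ← ofReal_integral_norm_eq_lintegral_enorm
      (hf.integrable t), ← integral_neg]
    congr 1
    refine integral_congr_ae ?_
    filter_upwards [hf_nonpos t] with ω hω
    rw [Real.norm_eq_abs, abs_of_nonpos hω]
  rw [h_eLpNorm]
  refine ENNReal.ofReal_le_ofReal (neg_le_neg ?_)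
  simpa [setIntegral_univ] using hf.setIntegral_le (zero_le (a := t)) MeasurableSet.univ

end Conditioning

section Zeta

variable {N : ℕ} (ρ : ℝ≥0) (κ : ProbabilityMeasure (Fin N → ℝ≥0)) (c : ℝ≥0)

/-- The function `z ↦ ∫ c ρ / (z ρ + |x|) κ(dx)`, whose crossing of the level `1` defines `ζ`. -/
noncomputable def bankIntegral (z : ℝ≥0) : ℝ≥0∞ :=
  ∫⁻ x, ((c * ρ : ℝ≥0) : ℝ≥0∞) / ((z * ρ + ∑ n, x n : ℝ≥0) : ℝ≥0∞)
    ∂(κ : Measure (Fin N → ℝ≥0))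

theorem bankIntegral_antitone : Antitone (bankIntegral ρ κ c) := fun z z' h =>
  lintegral_mono fun x => ENNReal.div_le_div_left (by gcongr) _

theorem inGamma_iff : InGamma ρ κ c ↔ 1 < bankIntegral ρ κ c 0 := by
  simp only [InGamma, bankIntegral, zero_mul, zero_add]

theorem bankIntegral_self_le : bankIntegral ρ κ c c ≤ 1 := by
  calc bankIntegral ρ κ c c ≤ ∫⁻ _, 1 ∂(κ : Measure (Fin N → ℝ≥0)) := by
        refine lintegral_mono fun x => ENNReal.div_le_of_le_mul ?_
        rw [one_mul]
        exact ENNReal.coe_le_coe.2 le_self_add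
    _ = 1 := by simp

variable {ρ κ c} in
theorem mul_ne_zero_of_one_le_bankIntegral {z : ℝ≥0} (h : 1 ≤ bankIntegral ρ κ c z) :
    c * ρ ≠ 0 := by
  rintro h₀
  simp [bankIntegral, h₀] at h

theorem tendsto_bankIntegrand (z : ℝ≥0) (x : Fin N → ℝ≥0) :
    Tendsto (fun z : ℝ≥0 => ((c * ρ : ℝ≥0) : ℝ≥0∞) / ((z * ρ + ∑ n, x n : ℝ≥0) : ℝ≥0∞))
      (nhds z) (nhds (((c * ρ : ℝ≥0) : ℝ≥0∞) / ((z * ρ + ∑ n, x n : ℝ≥0) : ℝ≥0∞))) := by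
  refine ENNReal.Tendsto.const_div (ENNReal.tendsto_coe.2 ?_) (Or.inr ENNReal.coe_ne_top)
  exact Continuous.tendsto (by fun_prop) z

theorem tendsto_bankIntegral_one_div :
    Tendsto (fun n : ℕ => bankIntegral ρ κ c (1 / ((n : ℝ≥0) + 1))) atTop
      (nhds (bankIntegral ρ κ c 0)) := by
  refine lintegral_tendsto_of_tendsto_of_monotone (fun n => by fun_prop)
    (ae_of_all _ fun x n n' h => ENNReal.div_le_div_left ?_ _)
    (ae_of_all _ fun x => (tendsto_bankIntegrand ρ c 0 x).comp
      tendsto_one_div_add_atTop_nhds_zero_nat)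
  gcongr

theorem bankIntegrand_le {z z' : ℝ≥0} (hρ : ρ ≠ 0) (hz : z ≠ 0) (h : z ≤ z')
    (x : Fin N → ℝ≥0) :
    ((c * ρ : ℝ≥0) : ℝ≥0∞) / ((z' * ρ + ∑ n, x n : ℝ≥0) : ℝ≥0∞) ≤ ((c / z : ℝ≥0) : ℝ≥0∞) := by
  calc ((c * ρ : ℝ≥0) : ℝ≥0∞) / ((z' * ρ + ∑ n, x n : ℝ≥0) : ℝ≥0∞)
      ≤ ((c * ρ : ℝ≥0) : ℝ≥0∞) / ((z * ρ : ℝ≥0) : ℝ≥0∞) := by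
        gcongr
        exact (mul_le_mul_left h ρ).trans le_self_add
    _ = ((c / z : ℝ≥0) : ℝ≥0∞) := by
        rw [← ENNReal.coe_div (mul_ne_zero hz hρ), mul_div_mul_right _ _ hρ]

theorem continuousAt_bankIntegral (hρ : ρ ≠ 0) {z : ℝ≥0} (hz : z ≠ 0) :
    ContinuousAt (bankIntegral ρ κ c) z := by
  refine tendsto_lintegral_filter_of_dominated_convergence
    (fun _ => ((c / (z / 2) : ℝ≥0) : ℝ≥0∞)) (Eventually.of_forall fun z' => by fun_prop) ?_
    (by simp) (ae_of_all _ (tendsto_bankIntegrand ρ c z))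
  filter_upwards [lt_mem_nhds (NNReal.half_lt_self hz)] with z' hz'
  exact ae_of_all _ (bankIntegrand_le ρ c hρ (by simpa using hz) hz'.le)

theorem exists_solvesZeta (h : InGamma ρ κ c) : ∃ z, SolvesZeta ρ κ c z := by
  rw [inGamma_iff] at h
  have hρ : ρ ≠ 0 := right_ne_zero_of_mul (mul_ne_zero_of_one_le_bankIntegral h.le)
  obtain ⟨z₀, hz₀, hz₀_lt⟩ : ∃ z₀ : ℝ≥0, 0 < z₀ ∧ 1 < bankIntegral ρ κ c z₀ := by
    obtain ⟨n, hn⟩ := ((tendsto_bankIntegral_one_div ρ κ c).eventually (lt_mem_nhds h)).exists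
    exact ⟨1 / ((n : ℝ≥0) + 1), by positivity, hn⟩
  have hz₀_le : z₀ ≤ c := le_of_not_ge fun hc =>
    ((bankIntegral_antitone ρ κ c hc).trans (bankIntegral_self_le ρ κ c)).not_gt hz₀_lt
  obtain ⟨z, hz, hz_eq⟩ := intermediate_value_Icc' hz₀_le
    (fun z hz => (continuousAt_bankIntegral ρ κ c hρ
      (hz₀.trans_le hz.1).ne').continuousWithinAt)
    (show (1 : ℝ≥0∞) ∈ Set.Icc _ _ from ⟨bankIntegral_self_le ρ κ c, hz₀_lt.le⟩)
  exact ⟨z, hz₀.trans_le hz.1, hz.2, hz_eq⟩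

theorem solvesZeta_zeta (h : InGamma ρ κ c) : SolvesZeta ρ κ c (zeta ρ κ c) := by
  have h' : InGamma ρ κ c ∧ ∃ z, SolvesZeta ρ κ c z := ⟨h, exists_solvesZeta ρ κ c h⟩
  rw [zeta, dif_pos h']
  exact h'.2.choose_spec

theorem zeta_eq_zero (h : ¬ InGamma ρ κ c) : zeta ρ κ c = 0 := by
  rw [zeta, dif_neg fun h' => h h'.1]

variable {ρ κ c} in
theorem bankIntegral_lt_bankIntegral {z z' : ℝ≥0} (hz : z < z') (hcρ : c * ρ ≠ 0)
    (h_fin : bankIntegral ρ κ c z' ≠ ∞) : bankIntegral ρ κ c z' < bankIntegral ρ κ c z := by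
  have hρ : 0 < ρ := pos_of_ne_zero (right_ne_zero_of_mul hcρ)
  refine lintegral_strict_mono (IsProbabilityMeasure.ne_zero _) (by fun_prop) h_fin
    (ae_of_all _ fun x => ENNReal.div_lt_div_left (by simpa using hcρ)
      ENNReal.coe_ne_top (ENNReal.coe_lt_coe.2 ?_))
  gcongr

theorem lt_zeta_iff (z : ℝ≥0) : z < zeta ρ κ c ↔ 1 < bankIntegral ρ κ c z := by
  by_cases h : InGamma ρ κ c
  · have h_eq : bankIntegral ρ κ c (zeta ρ κ c) = 1 := (solvesZeta_zeta ρ κ c h).2.2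
    refine ⟨fun hz => ?_, fun hz => lt_of_not_ge fun hz' => ?_⟩
    · rw [← h_eq]
      exact bankIntegral_lt_bankIntegral hz (mul_ne_zero_of_one_le_bankIntegral h_eq.ge)
        (by simp [h_eq])
    · exact ((bankIntegral_antitone ρ κ c hz').trans h_eq.le).not_gt hz
  · rw [zeta_eq_zero ρ κ c h]
    rw [inGamma_iff, not_lt] at h
    exact iff_of_false not_lt_zero ((bankIntegral_antitone ρ κ c zero_le).trans h).not_gt

theorem bankIntegral_zeta_le : bankIntegral ρ κ c (zeta ρ κ c) ≤ 1 :=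
  not_lt.1 fun h => lt_irrefl _ ((lt_zeta_iff ρ κ c _).2 h)

theorem zeta_mul_bankIntegral_zeta :
    zeta ρ κ c * bankIntegral ρ κ c (zeta ρ κ c) = zeta ρ κ c := by
  by_cases h : InGamma ρ κ c
  · rw [show bankIntegral ρ κ c (zeta ρ κ c) = 1 from (solvesZeta_zeta ρ κ c h).2.2, mul_one]
  · rw [zeta_eq_zero ρ κ c h, ENNReal.coe_zero, zero_mul]

theorem coe_hatProportion (a : ℝ≥0) (n : Fin N) :
    (hatProportion a κ n : ℝ≥0∞)
      = ∫⁻ x, (x n : ℝ≥0∞) / ((a + ∑ k, x k : ℝ≥0) : ℝ≥0∞) ∂(κ : Measure (Fin N → ℝ≥0)) := by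
  refine ENNReal.coe_toNNReal (ne_top_of_le_ne_top ENNReal.one_ne_top ?_)
  calc _ ≤ ∫⁻ _, 1 ∂(κ : Measure (Fin N → ℝ≥0)) := by
        refine lintegral_mono fun x => ENNReal.div_le_of_le_mul ?_
        rw [one_mul]
        refine ENNReal.coe_le_coe.2 (le_add_left ?_)
        exact Finset.single_le_sum (f := x) (fun _ _ => zero_le) (Finset.mem_univ n)
    _ = 1 := by simp

theorem zeta_add_mul_sum_hatProportion_le :
    zeta ρ κ c + c * ∑ n, hatProportion (zeta ρ κ c * ρ) κ n ≤ c := by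
  rw [← ENNReal.coe_le_coe]
  push_cast
  rw [← zeta_mul_bankIntegral_zeta]
  simp only [coe_hatProportion]
  set z := zeta ρ κ c
  calc z * bankIntegral ρ κ c z
        + c * ∑ n, ∫⁻ x, (x n : ℝ≥0∞) / ((z * ρ + ∑ k, x k : ℝ≥0) : ℝ≥0∞)
          ∂(κ : Measure (Fin N → ℝ≥0))
      = ∫⁻ x, z * (((c * ρ : ℝ≥0) : ℝ≥0∞) / ((z * ρ + ∑ n, x n : ℝ≥0) : ℝ≥0∞))
          + c * ∑ n, (x n : ℝ≥0∞) / ((z * ρ + ∑ k, x k : ℝ≥0) : ℝ≥0∞)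
          ∂(κ : Measure (Fin N → ℝ≥0)) := by
        rw [lintegral_add_left (by fun_prop), lintegral_const_mul _ (by fun_prop),
          lintegral_const_mul _ (by fun_prop), lintegral_finsetSum _ (by fun_prop), bankIntegral]
    _ ≤ ∫⁻ _, c ∂(κ : Measure (Fin N → ℝ≥0)) := by
        refine lintegral_mono fun x => ?_
        simp only [div_eq_mul_inv]
        rw [← Finset.sum_mul, ← mul_assoc, ← mul_assoc, ← add_mul, ← div_eq_mul_inv]
        refine ENNReal.div_le_of_le_mul (le_of_eq ?_)
        push_cast
        ring
    _ = c := by simp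

end Zeta

section ZetaMeasurable

variable {T : Type*} [MeasurableSpace T] {N : ℕ} {κ : T → ProbabilityMeasure (Fin N → ℝ≥0)}

theorem measurable_zeta
    (hκ : ∀ A, MeasurableSet A → Measurable fun τ => (κ τ : Measure (Fin N → ℝ≥0)) A)
    {ρ c : T → ℝ≥0} (hρ : Measurable ρ) (hc : Measurable c) :
    Measurable fun τ => zeta (ρ τ) (κ τ) (c τ) := by
  refine measurable_of_Ioi fun z => ?_
  simp only [Set.preimage, Set.mem_Ioi, lt_zeta_iff]
  refine measurableSet_lt measurable_const ?_
  exact measurable_lintegral_of_forall_measurable hκ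
    (f := fun p => ((c p.1 * ρ p.1 : ℝ≥0) : ℝ≥0∞) / ((z * ρ p.1 + ∑ n, p.2 n : ℝ≥0) : ℝ≥0∞))
    (by fun_prop)

theorem measurable_hatProportion
    (hκ : ∀ A, MeasurableSet A → Measurable fun τ => (κ τ : Measure (Fin N → ℝ≥0)) A)
    {a : T → ℝ≥0} (ha : Measurable a) :
    Measurable fun τ => hatProportion (a τ) (κ τ) := by
  refine measurable_pi_lambda _ fun n => Measurable.ennreal_toNNReal ?_
  exact measurable_lintegral_of_forall_measurable hκ
    (f := fun p => (p.2 n : ℝ≥0∞) / ((a p.1 + ∑ k, p.2 k : ℝ≥0) : ℝ≥0∞)) (by fun_prop)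

end ZetaMeasurable

section Wealth

variable {Ω : Type*} [mΩ : MeasurableSpace Ω] {P : Measure Ω} {F : Filtration ℕ mΩ} {M N : ℕ}

theorem measurable_wealthStep {T : Type*} [MeasurableSpace T] {ρ : T → ℝ≥0}
    {x : T → Fin N → ℝ≥0} {l : T → JointProportions M N} {y : T → Fin M → ℝ≥0}
    (hρ : Measurable ρ) (hx : Measurable x) (hl : Measurable l) (hy : Measurable y) :
    Measurable fun τ => wealthStep (ρ τ) (x τ) (l τ) (y τ) := by
  have hl' : ∀ m n, Measurable fun τ => (l τ m).1 n := fun m n =>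
    (measurable_pi_apply n).comp (measurable_subtype_coe.comp ((measurable_pi_apply m).comp hl))
  unfold wealthStep
  fun_prop

theorem Market.measurable_wealthOfHistory (S : Market P F N) {T : Type*} [mT : MeasurableSpace T]
    {φ : T → Ω} {y : T → Fin M → ℝ≥0} (hy : Measurable y) :
    ∀ (t : ℕ) {h : T → Fin t → JointProportions M N}, Measurable[mT, F t] φ → Measurable h →
      Measurable fun τ => S.wealthOfHistory (φ τ) (y τ) t (h τ)
  | 0, _, _, _ => hy
  | t + 1, h, hφ, hh => by
    have hφ' : Measurable[mT, F t] φ := hφ.mono le_rfl (F.mono t.le_succ)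
    refine measurable_wealthStep ((S.predictable_ρ t).comp hφ') ((S.adapted_X t).comp hφ)
      ((measurable_pi_apply _).comp hh) ?_
    exact measurable_wealthOfHistory S hy t hφ'
      (measurable_pi_lambda _ fun s => (measurable_pi_apply _).comp hh)

theorem Market.isStrategy_hatRule {S : Market P F N}
    {K : ℕ → Ω → ProbabilityMeasure (Fin N → ℝ≥0)} (hK : S.IsRegularConditionalLaw K) :
    IsStrategy F (S.hatRule K : Rule Ω M N) := by
  intro t
  let mT : MeasurableSpace (Ω × ((Fin M → ℝ≥0) × (Fin t → JointProportions M N))) :=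
    (F t).prod inferInstance
  have hfst : Measurable[mT, F t] Prod.fst := @measurable_fst _ _ (F t) _
  have hsnd : Measurable[mT] Prod.snd := @measurable_snd _ _ (F t) _
  have hκ : ∀ A, MeasurableSet A → Measurable[mT] fun p =>
      (K (t + 1) p.1 : Measure (Fin N → ℝ≥0)) A := fun A hA => (hK.measurable t A hA).comp hfst
  have hρ : Measurable[mT] fun p => S.ρ (t + 1) p.1 := (S.predictable_ρ t).comp hfst
  have hw : Measurable[mT] fun p => S.wealthOfHistory p.1 p.2.1 t p.2.2 :=
    S.measurable_wealthOfHistory (measurable_fst.comp hsnd) t hfst (measurable_snd.comp hsnd)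
  have hC : Measurable[mT] fun p => ∑ m, S.wealthOfHistory p.1 p.2.1 t p.2.2 m :=
    Finset.measurable_sum _ fun m _ => (measurable_pi_apply m).comp hw
  exact (measurable_hatProportion hκ ((measurable_zeta hκ hρ hC).mul hρ)).subtype_mk

/-- The joint proportions `λ_{t+1}` realized when the investors use the profile `L`. -/
def realizedProportions (L : Fin M → Rule Ω M N) (y₀ : Fin M → ℝ≥0) (t : ℕ) (ω : Ω) :
    JointProportions M N :=
  fun m => L m t ω y₀ (realization L y₀ ω t)

theorem IsStrategy.measurable_apply {Λ : Rule Ω M N} (hΛ : IsStrategy F Λ) (y₀ : Fin M → ℝ≥0)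
    {t : ℕ} {h : Ω → Fin t → JointProportions M N} (hh : Measurable[F t] h) :
    Measurable[F t] fun ω => Λ t ω y₀ (h ω) :=
  (hΛ t).comp (@Measurable.prodMk _ (F t) _ _ (F t) _ id _ (@measurable_id _ (F t))
    (Measurable.prodMk (measurable_const (a := y₀)) hh))

theorem measurable_realization {L : Fin M → Rule Ω M N} (hL : ∀ m, IsStrategy F (L m))
    (y₀ : Fin M → ℝ≥0) : ∀ t, Measurable[F t] fun ω => realization L y₀ ω t
  | 0 => @measurable_pi_lambda _ _ _ (F 0) _ _ fun s => s.elim0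
  | t + 1 => by
    have ih := measurable_realization hL y₀ t
    refine Measurable.mono ?_ (F.mono t.le_succ) le_rfl
    refine @measurable_pi_lambda _ _ _ (F t) _ _ fun s => ?_
    refine Fin.lastCases ?_ (fun s => ?_) s
    · simp only [realization, Fin.snoc_last]
      exact @measurable_pi_lambda _ _ _ (F t) _ _ fun m => (hL m).measurable_apply y₀ ih
    · simp only [realization, Fin.snoc_castSucc]
      exact (measurable_pi_apply s).comp ih

theorem measurable_realizedProportions {L : Fin M → Rule Ω M N} (hL : ∀ m, IsStrategy F (L m))
    (y₀ : Fin M → ℝ≥0) (t : ℕ) : Measurable[F t] (realizedProportions L y₀ t) :=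
  @measurable_pi_lambda _ _ _ (F t) _ _ fun m =>
    (hL m).measurable_apply y₀ (measurable_realization hL y₀ t)

namespace Market

variable (S : Market P F N)

section

variable {L : Fin M → Rule Ω M N}

theorem measurable_wealth (hL : ∀ m, IsStrategy F (L m)) (y₀ : Fin M → ℝ≥0) (t : ℕ) :
    Measurable[F t] fun ω m => S.wealth L y₀ t m ω :=
  @measurable_wealthOfHistory Ω mΩ P F M N S Ω (F t) id _ measurable_const t _
    (@measurable_id _ (F t)) (measurable_realization hL y₀ t)

theorem measurable_wealth_apply (hL : ∀ m, IsStrategy F (L m)) (y₀ : Fin M → ℝ≥0) (t : ℕ)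
    (m : Fin M) : Measurable[F t] (S.wealth L y₀ t m) :=
  (measurable_pi_apply m).comp (S.measurable_wealth hL y₀ t)

theorem measurable_sum_wealth (hL : ∀ m, IsStrategy F (L m)) (y₀ : Fin M → ℝ≥0) (t : ℕ) :
    Measurable[F t] fun ω => ∑ k, S.wealth L y₀ t k ω :=
  Finset.measurable_sum _ fun k _ => S.measurable_wealth_apply hL y₀ t k

theorem measurable_relWealth (hL : ∀ m, IsStrategy F (L m)) (y₀ : Fin M → ℝ≥0) (t : ℕ)
    (m : Fin M) : Measurable[F t] (S.relWealth L y₀ t m) :=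
  (S.measurable_wealth_apply hL y₀ t m).div (S.measurable_sum_wealth hL y₀ t)

end

variable (L : Fin M → Rule Ω M N) (y₀ : Fin M → ℝ≥0) (t : ℕ) (m : Fin M) (ω : Ω)

theorem wealth_succ :
    S.wealth L y₀ (t + 1) m ω = wealthStep (S.ρ (t + 1) ω) (S.X (t + 1) ω)
      (realizedProportions L y₀ t ω) (fun k => S.wealth L y₀ t k ω) m := by
  simp only [wealth, wealthOfHistory, realization, Fin.snoc_last, Fin.snoc_castSucc]
  rfl

theorem wealth_le_sum : S.wealth L y₀ t m ω ≤ ∑ k, S.wealth L y₀ t k ω :=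
  Finset.single_le_sum (f := fun k => S.wealth L y₀ t k ω) (fun _ _ => zero_le)
    (Finset.mem_univ m)

theorem relWealth_le_one : S.relWealth L y₀ t m ω ≤ 1 :=
  div_le_one_of_le₀ (S.wealth_le_sum L y₀ t m ω) zero_le

end Market

theorem Market.IsRegularConditionalLaw.condLExp_ae_eq [IsFiniteMeasure P] {S : Market P F N}
    {K : ℕ → Ω → ProbabilityMeasure (Fin N → ℝ≥0)} (hK : S.IsRegularConditionalLaw K) {t : ℕ}
    {T : Type*} [MeasurableSpace T] {φ : Ω → T} (hφ : Measurable[F t] φ)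
    {f : T × (Fin N → ℝ≥0) → ℝ≥0∞} (hf : Measurable f) :
    P⁻[fun ω => f (φ ω, S.X (t + 1) ω) | F t]
      =ᵐ[P] fun ω => ∫⁻ x, f (φ ω, x) ∂(K (t + 1) ω : Measure (Fin N → ℝ≥0)) := by
  have hX : Measurable (S.X (t + 1)) := (S.adapted_X t).mono (F.le _) le_rfl
  let mT : MeasurableSpace (Ω × (Fin N → ℝ≥0)) := (F t).prod inferInstance
  have hfst : Measurable[mT, F t] Prod.fst := @measurable_fst _ _ (F t) _
  have hsnd : Measurable[mT] Prod.snd := @measurable_snd _ _ (F t) _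
  refine condLExp_ae_eq_lintegral_of_condLaw (f := fun p => f (φ p.1, p.2)) (F.le t) hX
    (hK.measurable t) (fun A hA => ?_) (hf.comp ((hφ.comp hfst).prodMk hsnd))
  have hind : (fun ω => ENNReal.ofReal ((S.X (t + 1) ⁻¹' A).indicator (fun _ => (1 : ℝ)) ω))
      = (S.X (t + 1) ⁻¹' A).indicator 1 := by
    ext ω
    by_cases hω : ω ∈ S.X (t + 1) ⁻¹' A <;> simp [hω]
  rw [← hind]
  refine (condLExp_ofReal (F t) ((integrable_const 1).indicator (hX hA))
    (ae_of_all _ (Set.indicator_nonneg fun _ _ => zero_le_one))).trans ?_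
  filter_upwards [hK.condProb t A hA] with ω hω
  rw [← hω, ofReal_measureReal]

end Wealth

theorem sq_add_sum_le_mul {ι : Type*} [Fintype ι] (w : ℝ≥0) {x q : ι → ℝ≥0}
    (hxq : ∀ n, q n = 0 → x n = 0) :
    (w + ∑ n, x n) ^ 2 ≤ (w + ∑ n, q n * x n) * (w + ∑ n, x n / q n) := by
  have h := Finset.sum_sq_le_sum_mul_sum_of_sq_le_mul (Finset.univ : Finset (Option ι))
    (r := fun o => o.elim w x) (f := fun o => o.elim w fun n => q n * x n)
    (g := fun o => o.elim w fun n => x n / q n) (fun _ _ => zero_le) (fun _ _ => zero_le) ?_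
  · simpa [Fintype.sum_option] using h
  · rintro (_ | n) _
    · exact (sq w).le
    · by_cases hq : q n = 0
      · simp [hq, hxq n hq]
      · exact le_of_eq (by simp only [Option.elim]; field_simp)

theorem two_sub_le_log_div {W A V D : ℝ} (hW : 0 < W) (hA : 0 < A) (hD : 0 < D)
    (hWAV : W ^ 2 ≤ A * V) : 2 - (D + V) / W ≤ Real.log (A / D) := by
  have h_WD : 1 - D / W ≤ Real.log (W / D) := by
    simpa using Real.one_sub_inv_le_log_of_pos (div_pos hW hD)
  have h_AW : 1 - W / A ≤ Real.log (A / W) := by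
    simpa using Real.one_sub_inv_le_log_of_pos (div_pos hA hW)
  have h_le : W / A ≤ V / W := by
    rwa [div_le_div_iff₀ hA hW, ← sq, mul_comm V]
  calc 2 - (D + V) / W ≤ Real.log (A / W) + Real.log (W / D) := by
        rw [add_div]
        linarith
    _ = Real.log (A / D) := by
        rw [← Real.log_mul (by positivity) (by positivity), div_mul_div_cancel₀ hW.ne']

section OneStep

variable {M N : ℕ}

/-- The total amount kept in the bank account by investors with wealth `y` and proportions `l`. -/
noncomputable def bankTotal (l : JointProportions M N) (y : Fin M → ℝ≥0) : ℝ≥0 :=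
  ∑ k, (1 - ∑ n, (l k).1 n) * y k

/-- The total amount invested in asset `n` by investors with wealth `y` and proportions `l`. -/
noncomputable def assetTotal (l : JointProportions M N) (y : Fin M → ℝ≥0) (n : Fin N) : ℝ≥0 :=
  ∑ k, (l k).1 n * y k

/-- The proportion which investor `i` invests in asset `n`, relative to the proportion of the
total wealth invested in this asset by the whole market (zero if nobody invests in it). -/
noncomputable def relativeProportion (l : JointProportions M N) (y : Fin M → ℝ≥0) (i : Fin M)
    (n : Fin N) : ℝ≥0 :=
  (l i).1 n * (∑ k, y k) / assetTotal l y n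

/-- The random variable `U`, of conditional mean at most one if investor `i` uses `Λ̂`, such that
the logarithm of the relative wealth of this investor grows by at least `1 - U` in one step. -/
noncomputable def growthDefect (ρ : ℝ≥0) (x : Fin N → ℝ≥0) (l : JointProportions M N)
    (y : Fin M → ℝ≥0) (i : Fin M) (ζ : ℝ≥0) : ℝ≥0 :=
  (ρ * bankTotal l y + ∑ n, x n / relativeProportion l y i n) / (ζ * ρ + ∑ n, x n)

theorem bankTotal_add_sum_assetTotal (l : JointProportions M N) (y : Fin M → ℝ≥0) :
    bankTotal l y + ∑ n, assetTotal l y n = ∑ k, y k := by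
  unfold bankTotal assetTotal
  rw [Finset.sum_comm, ← Finset.sum_add_distrib]
  refine Finset.sum_congr rfl fun k _ => ?_
  rw [← Finset.sum_mul, ← add_mul, tsub_add_cancel_of_le (l k).2, one_mul]

theorem sum_wealthStep_le (ρ : ℝ≥0) (x : Fin N → ℝ≥0) (l : JointProportions M N)
    (y : Fin M → ℝ≥0) : ∑ m, wealthStep ρ x l y m ≤ ρ * bankTotal l y + ∑ n, x n := by
  unfold wealthStep
  rw [Finset.sum_add_distrib]
  refine add_le_add (le_of_eq ?_)
    (Finset.sum_comm.trans_le (Finset.sum_le_sum fun n _ => ?_))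
  · rw [bankTotal, Finset.mul_sum]
    exact Finset.sum_congr rfl fun k _ => mul_assoc _ _ _
  · rw [← Finset.sum_mul, ← Finset.sum_div]
    exact mul_le_of_le_one_left' (div_self_le_one _)

theorem sum_wealthStep_le_mul_sum_add (ρ : ℝ≥0) (x : Fin N → ℝ≥0) (l : JointProportions M N)
    (y : Fin M → ℝ≥0) : ∑ m, wealthStep ρ x l y m ≤ ρ * ∑ k, y k + ∑ n, x n := by
  refine (sum_wealthStep_le ρ x l y).trans ?_
  gcongr
  exact le_self_add.trans_eq (bankTotal_add_sum_assetTotal l y)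

section

variable {ρ : ℝ≥0} {x : Fin N → ℝ≥0} {l : JointProportions M N} {y : Fin M → ℝ≥0} {i : Fin M}
  {ζ : ℝ≥0}

theorem eq_zero_of_relativeProportion_eq_zero (hy : 0 < y i) {n : Fin N}
    (h : relativeProportion l y i n = 0) : (l i).1 n = 0 := by
  by_contra hl
  have hC : ∑ k, y k ≠ 0 := (Finset.sum_pos' (fun _ _ => zero_le) ⟨i, Finset.mem_univ i, hy⟩).ne'
  have hA : assetTotal l y n ≠ 0 := (Finset.sum_pos' (fun _ _ => zero_le)
    ⟨i, Finset.mem_univ i, mul_pos (pos_of_ne_zero hl) hy⟩).ne'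
  exact div_ne_zero (mul_ne_zero hl hC) hA h

theorem mul_le_wealthStep_mul_sum (hζ : ζ + (∑ k, y k) * ∑ n, (l i).1 n ≤ ∑ k, y k) :
    (ζ * ρ + ∑ n, relativeProportion l y i n * x n) * y i
      ≤ wealthStep ρ x l y i * ∑ k, y k := by
  have hζ' : ζ ≤ (∑ k, y k) * (1 - ∑ n, (l i).1 n) := by
    rw [mul_tsub, mul_one]
    exact le_tsub_of_add_le_right hζ
  rw [wealthStep, add_mul, add_mul, Finset.sum_mul, Finset.sum_mul]
  refine add_le_add ?_ (Finset.sum_le_sum fun n _ => le_of_eq ?_)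
  · calc ζ * ρ * y i ≤ (∑ k, y k) * (1 - ∑ n, (l i).1 n) * ρ * y i := by gcongr
      _ = ρ * (1 - ∑ n, (l i).1 n) * y i * ∑ k, y k := by ring
  · rw [relativeProportion, assetTotal]
    ring

theorem add_sum_relativeProportion_mul_pos (hy : 0 < y i) (hW : 0 < ζ * ρ + ∑ n, x n)
    (hx : ∀ n, (l i).1 n = 0 → x n = 0) :
    0 < ζ * ρ + ∑ n, relativeProportion l y i n * x n :=
  pos_of_ne_zero fun h => (pow_pos hW 2).not_ge <| by
    simpa [h] using sq_add_sum_le_mul (ζ * ρ) fun n hn =>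
      hx n (eq_zero_of_relativeProportion_eq_zero hy hn)

theorem wealthStep_pos (hy : 0 < y i) (hW : 0 < ζ * ρ + ∑ n, x n)
    (hζ : ζ + (∑ k, y k) * ∑ n, (l i).1 n ≤ ∑ k, y k) (hx : ∀ n, (l i).1 n = 0 → x n = 0) :
    0 < wealthStep ρ x l y i :=
  pos_of_mul_pos_left ((mul_pos (add_sum_relativeProportion_mul_pos hy hW hx) hy).trans_le
    (mul_le_wealthStep_mul_sum hζ)) zero_le

theorem sum_wealthStep_add_le (hW : 0 < ζ * ρ + ∑ n, x n) :
    ∑ m, wealthStep ρ x l y m + (ζ * ρ + ∑ n, x n / relativeProportion l y i n)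
      ≤ (1 + growthDefect ρ x l y i ζ) * (ζ * ρ + ∑ n, x n) := by
  rw [growthDefect, add_mul, one_mul, div_mul_cancel₀ _ hW.ne']
  calc _ ≤ ρ * bankTotal l y + ∑ n, x n + (ζ * ρ + ∑ n, x n / relativeProportion l y i n) := by
        gcongr
        exact sum_wealthStep_le ρ x l y
    _ = _ := by ring

theorem log_add_one_sub_growthDefect_le (hy : 0 < y i) (hW : 0 < ζ * ρ + ∑ n, x n)
    (hζ : ζ + (∑ k, y k) * ∑ n, (l i).1 n ≤ ∑ k, y k) (hx : ∀ n, (l i).1 n = 0 → x n = 0) :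
    Real.log ((y i / ∑ k, y k : ℝ≥0) : ℝ) + (1 - (growthDefect ρ x l y i ζ : ℝ))
      ≤ Real.log ((wealthStep ρ x l y i / ∑ k, wealthStep ρ x l y k : ℝ≥0) : ℝ) := by
  set C : ℝ≥0 := ∑ k, y k
  set D : ℝ≥0 := ∑ k, wealthStep ρ x l y k
  set U : ℝ≥0 := growthDefect ρ x l y i ζ
  set A : ℝ≥0 := ζ * ρ + ∑ n, relativeProportion l y i n * x n
  set W : ℝ≥0 := ζ * ρ + ∑ n, x n
  set V : ℝ≥0 := ζ * ρ + ∑ n, x n / relativeProportion l y i n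
  have hA : 0 < A := add_sum_relativeProportion_mul_pos hy hW hx
  have hC : 0 < C := Finset.sum_pos' (fun _ _ => zero_le) ⟨i, Finset.mem_univ i, hy⟩
  have hD : 0 < D := Finset.sum_pos' (fun _ _ => zero_le)
    ⟨i, Finset.mem_univ i, wealthStep_pos hy hW hζ hx⟩
  have hCS : W ^ 2 ≤ A * V := sq_add_sum_le_mul (ζ * ρ) fun n hn =>
    hx n (eq_zero_of_relativeProportion_eq_zero hy hn)
  have h_sub : 1 - (U : ℝ) ≤ 2 - ((D : ℝ) + V) / W := by
    have : ((D : ℝ) + V) / W ≤ 1 + U := by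
      rw [div_le_iff₀ (by exact_mod_cast hW)]
      exact_mod_cast sum_wealthStep_add_le (l := l) (y := y) (i := i) hW
    linarith
  have h_ratio : y i / C * (A / D) ≤ wealthStep ρ x l y i / D := by
    rw [← mul_div_assoc]
    gcongr
    rw [div_mul_eq_mul_div, div_le_iff₀ hC, mul_comm]
    exact mul_le_wealthStep_mul_sum hζ
  calc _ ≤ Real.log ((y i / C : ℝ≥0) : ℝ) + Real.log ((A / D : ℝ≥0) : ℝ) := by
        gcongr
        push_cast
        exact h_sub.trans (two_sub_le_log_div (by exact_mod_cast hW) (by exact_mod_cast hA)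
          (by exact_mod_cast hD) (by exact_mod_cast hCS))
    _ = Real.log ((y i / C * (A / D) : ℝ≥0) : ℝ) := by
        rw [NNReal.coe_mul, Real.log_mul] <;> exact_mod_cast (div_pos ‹_› ‹_›).ne'
    _ ≤ _ := Real.log_le_log (by exact_mod_cast mul_pos (div_pos hy hC) (div_pos hA hD))
        (by exact_mod_cast h_ratio)

end

theorem coe_growthDefect_le (ρ : ℝ≥0) (x : Fin N → ℝ≥0) (l : JointProportions M N)
    (y : Fin M → ℝ≥0) (i : Fin M) (ζ : ℝ≥0) :
    (growthDefect ρ x l y i ζ : ℝ≥0∞)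
      ≤ ((bankTotal l y / ∑ k, y k : ℝ≥0) : ℝ≥0∞) * ((((∑ k, y k) * ρ : ℝ≥0) : ℝ≥0∞)
          / ((ζ * ρ + ∑ n, x n : ℝ≥0) : ℝ≥0∞))
        + ∑ n, (((relativeProportion l y i n)⁻¹ : ℝ≥0) : ℝ≥0∞)
          * ((x n : ℝ≥0∞) / ((ζ * ρ + ∑ n, x n : ℝ≥0) : ℝ≥0∞)) := by
  have hB : bankTotal l y / (∑ k, y k) * (∑ k, y k) = bankTotal l y :=
    div_mul_cancel_of_imp fun h => nonpos_iff_eq_zero.1 <|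
      (le_self_add.trans_eq (bankTotal_add_sum_assetTotal l y)).trans_eq h
  refine ENNReal.coe_div_le.trans (le_of_eq ?_)
  simp only [div_eq_mul_inv (_ : ℝ≥0∞), ← mul_assoc]
  rw [← Finset.sum_mul, ← add_mul]
  norm_cast
  rw [← mul_assoc, hB, mul_comm ρ]
  simp only [div_eq_inv_mul]

theorem inv_relativeProportion_mul_le (l : JointProportions M N) (y : Fin M → ℝ≥0) (i : Fin M)
    (n : Fin N) :
    (relativeProportion l y i n)⁻¹ * (l i).1 n ≤ assetTotal l y n / ∑ k, y k := by
  calc (relativeProportion l y i n)⁻¹ * (l i).1 n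
      = (l i).1 n / (l i).1 n * (assetTotal l y n / ∑ k, y k) := by
        rw [relativeProportion, inv_div, div_mul_eq_mul_div, div_mul_div_comm, mul_comm]
    _ ≤ _ := mul_le_of_le_one_left' (div_self_le_one _)

theorem lintegral_growthDefect_le (ρ : ℝ≥0) {l : JointProportions M N} (y : Fin M → ℝ≥0)
    {i : Fin M} {ζ : ℝ≥0} {κ : ProbabilityMeasure (Fin N → ℝ≥0)}
    (hζ : bankIntegral ρ κ (∑ k, y k) ζ ≤ 1) (hl : (l i).1 = hatProportion (ζ * ρ) κ) :
    ∫⁻ x, (growthDefect ρ x l y i ζ : ℝ≥0∞) ∂(κ : Measure (Fin N → ℝ≥0)) ≤ 1 := by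
  calc _ ≤ _ := lintegral_mono fun x => coe_growthDefect_le ρ x l y i ζ
    _ = ((bankTotal l y / ∑ k, y k : ℝ≥0) : ℝ≥0∞) * bankIntegral ρ κ (∑ k, y k) ζ
        + ∑ n, (((relativeProportion l y i n)⁻¹ * (l i).1 n : ℝ≥0) : ℝ≥0∞) := by
      rw [lintegral_add_left (by fun_prop), lintegral_const_mul _ (by fun_prop),
        lintegral_finsetSum _ (by fun_prop), hl]
      simp only [ENNReal.coe_mul, coe_hatProportion]
      congr! 2 with n
      exact lintegral_const_mul _ (by fun_prop)
    _ ≤ ((bankTotal l y / ∑ k, y k : ℝ≥0) : ℝ≥0∞) * 1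
        + ∑ n, ((assetTotal l y n / ∑ k, y k : ℝ≥0) : ℝ≥0∞) := by
      gcongr with n
      exact inv_relativeProportion_mul_le l y i n
    _ ≤ 1 := by
      norm_cast
      rw [mul_one, ← Finset.sum_div, ← add_div, bankTotal_add_sum_assetTotal]
      exact div_self_le_one _

theorem measurable_growthDefect {T : Type*} [MeasurableSpace T] {ρ ζ : T → ℝ≥0}
    {x : T → Fin N → ℝ≥0} {l : T → JointProportions M N} {y : T → Fin M → ℝ≥0} (i : Fin M)
    (hρ : Measurable ρ) (hx : Measurable x) (hl : Measurable l) (hy : Measurable y)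
    (hζ : Measurable ζ) :
    Measurable fun τ => growthDefect (ρ τ) (x τ) (l τ) (y τ) i (ζ τ) := by
  have hl' : ∀ m n, Measurable fun τ => (l τ m).1 n := fun m n =>
    (measurable_pi_apply n).comp (measurable_subtype_coe.comp ((measurable_pi_apply m).comp hl))
  unfold growthDefect relativeProportion bankTotal assetTotal
  fun_prop

end OneStep

section HatRule

namespace Market

variable {Ω : Type*} [mΩ : MeasurableSpace Ω] {P : Measure Ω} {F : Filtration ℕ mΩ} {M N : ℕ}
  {S : Market P F N} {K : ℕ → Ω → ProbabilityMeasure (Fin N → ℝ≥0)} {L : Fin M → Rule Ω M N}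
  {i : Fin M}

/-- The value `ζ_{t+1}(C_t)` realized when the investors use the profile `L`. -/
noncomputable def realizedZeta (S : Market P F N)
    (K : ℕ → Ω → ProbabilityMeasure (Fin N → ℝ≥0)) (L : Fin M → Rule Ω M N)
    (y₀ : Fin M → ℝ≥0) (t : ℕ) (ω : Ω) : ℝ≥0 :=
  zeta (S.ρ (t + 1) ω) (K (t + 1) ω) (∑ k, S.wealth L y₀ t k ω)

/-- The growth defect of investor `i` between the times `t` and `t + 1`, realized when the
investors use the profile `L`. -/
noncomputable def realizedGrowthDefect (S : Market P F N)
    (K : ℕ → Ω → ProbabilityMeasure (Fin N → ℝ≥0)) (L : Fin M → Rule Ω M N)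
    (y₀ : Fin M → ℝ≥0) (i : Fin M) (t : ℕ) (ω : Ω) : ℝ≥0 :=
  growthDefect (S.ρ (t + 1) ω) (S.X (t + 1) ω) (realizedProportions L y₀ t ω)
    (fun k => S.wealth L y₀ t k ω) i (S.realizedZeta K L y₀ t ω)

theorem realizedProportions_hatRule (hi : L i = S.hatRule K) (y₀ : Fin M → ℝ≥0) (t : ℕ) (ω : Ω) :
    (realizedProportions L y₀ t ω i).1
      = hatProportion (S.realizedZeta K L y₀ t ω * S.ρ (t + 1) ω) (K (t + 1) ω) := by
  simp only [realizedProportions, hi]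
  rfl

theorem measurable_realizedZeta (hK : S.IsRegularConditionalLaw K)
    (hL : ∀ m, IsStrategy F (L m)) (y₀ : Fin M → ℝ≥0) (t : ℕ) :
    Measurable[F t] (S.realizedZeta K L y₀ t) :=
  @measurable_zeta _ (F t) _ _ (hK.measurable t) _ _ (S.predictable_ρ t)
    (S.measurable_sum_wealth hL y₀ t)

theorem measurable_realizedGrowthDefect (hK : S.IsRegularConditionalLaw K)
    (hL : ∀ m, IsStrategy F (L m)) (y₀ : Fin M → ℝ≥0) (i : Fin M) (t : ℕ) :
    Measurable (S.realizedGrowthDefect K L y₀ i t) :=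
  measurable_growthDefect i ((S.predictable_ρ t).mono (F.le _) le_rfl)
    ((S.adapted_X t).mono (F.le _) le_rfl)
    ((measurable_realizedProportions hL y₀ t).mono (F.le _) le_rfl)
    ((S.measurable_wealth hL y₀ t).mono (F.le _) le_rfl)
    ((measurable_realizedZeta hK hL y₀ t).mono (F.le _) le_rfl)

theorem zeta_add_mul_sum_realizedProportions_le (hi : L i = S.hatRule K) (y₀ : Fin M → ℝ≥0)
    (t : ℕ) (ω : Ω) :
    S.realizedZeta K L y₀ t ω
        + (∑ k, S.wealth L y₀ t k ω) * ∑ n, (realizedProportions L y₀ t ω i).1 n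
      ≤ ∑ k, S.wealth L y₀ t k ω := by
  rw [realizedProportions_hatRule hi]
  exact zeta_add_mul_sum_hatProportion_le _ _ _

variable [IsFiniteMeasure P]

theorem condLExp_bankIntegrand_le_one (hK : S.IsRegularConditionalLaw K)
    (hL : ∀ m, IsStrategy F (L m)) (y₀ : Fin M → ℝ≥0) (t : ℕ) :
    P⁻[fun ω => (((∑ k, S.wealth L y₀ t k ω) * S.ρ (t + 1) ω : ℝ≥0) : ℝ≥0∞)
      / ((S.realizedZeta K L y₀ t ω * S.ρ (t + 1) ω + ∑ n, S.X (t + 1) ω n : ℝ≥0) : ℝ≥0∞) | F t]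
      ≤ᵐ[P] 1 := by
  filter_upwards [hK.condLExp_ae_eq
    (φ := fun ω => (S.ρ (t + 1) ω, ∑ k, S.wealth L y₀ t k ω, S.realizedZeta K L y₀ t ω))
    (f := fun p => ((p.1.2.1 * p.1.1 : ℝ≥0) : ℝ≥0∞)
      / ((p.1.2.2 * p.1.1 + ∑ n, p.2 n : ℝ≥0) : ℝ≥0∞))
    ((S.predictable_ρ t).prodMk ((S.measurable_sum_wealth hL y₀ t).prodMk
      (measurable_realizedZeta hK hL y₀ t))) (by fun_prop)] with ω hω
  rw [hω]
  exact bankIntegral_zeta_le (S.ρ (t + 1) ω) (K (t + 1) ω) (∑ k, S.wealth L y₀ t k ω)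

theorem ae_pos_realizedZeta_mul_add (hK : S.IsRegularConditionalLaw K)
    (hL : ∀ m, IsStrategy F (L m)) (y₀ : Fin M → ℝ≥0) (t : ℕ) :
    ∀ᵐ ω ∂P, 0 < ∑ k, S.wealth L y₀ t k ω →
      0 < S.realizedZeta K L y₀ t ω * S.ρ (t + 1) ω + ∑ n, S.X (t + 1) ω n := by
  have hC := (S.measurable_sum_wealth hL y₀ t).mono (F.le t) le_rfl
  have hρ := (S.predictable_ρ t).mono (F.le t) le_rfl
  have hζ := (measurable_realizedZeta hK hL y₀ t).mono (F.le t) le_rfl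
  have hX : Measurable (S.X (t + 1)) := (S.adapted_X t).mono (F.le _) le_rfl
  filter_upwards [S.pos t, ae_lt_top (by fun_prop)
    (lintegral_ne_top_of_condLExp_le_one (F.le t) (condLExp_bankIntegrand_le_one hK hL y₀ t))]
    with ω hpos h_lt_top hC_pos
  refine pos_of_ne_zero fun h_zero => h_lt_top.ne ?_
  rw [(add_eq_zero.1 h_zero).2, add_zero] at hpos
  rw [h_zero, ENNReal.coe_zero, ENNReal.div_zero (ENNReal.coe_ne_zero.2 (mul_pos hC_pos hpos).ne')]

theorem condLExp_hatIntegrand_ae_eq (hK : S.IsRegularConditionalLaw K)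
    (hL : ∀ m, IsStrategy F (L m)) (hi : L i = S.hatRule K) (y₀ : Fin M → ℝ≥0) (t : ℕ)
    (n : Fin N) :
    P⁻[fun ω => (S.X (t + 1) ω n : ℝ≥0∞)
      / ((S.realizedZeta K L y₀ t ω * S.ρ (t + 1) ω + ∑ k, S.X (t + 1) ω k : ℝ≥0) : ℝ≥0∞) | F t]
      =ᵐ[P] fun ω => ((realizedProportions L y₀ t ω i).1 n : ℝ≥0∞) := by
  refine (hK.condLExp_ae_eq
    (f := fun p => (p.2 n : ℝ≥0∞) / ((p.1 + ∑ k, p.2 k : ℝ≥0) : ℝ≥0∞))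
    ((measurable_realizedZeta hK hL y₀ t).mul (S.predictable_ρ t)) (by fun_prop)).trans ?_
  refine ae_of_all _ fun ω => ?_
  beta_reduce
  rw [realizedProportions_hatRule hi, coe_hatProportion]
  rfl

theorem ae_eq_zero_of_realizedProportions_eq_zero (hK : S.IsRegularConditionalLaw K)
    (hL : ∀ m, IsStrategy F (L m)) (hi : L i = S.hatRule K) (y₀ : Fin M → ℝ≥0) (t : ℕ) :
    ∀ᵐ ω ∂P, ∀ n, (realizedProportions L y₀ t ω i).1 n = 0 → S.X (t + 1) ω n = 0 := by
  rw [ae_all_iff]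
  intro n
  have hρ := (S.predictable_ρ t).mono (F.le t) le_rfl
  have hζ := (measurable_realizedZeta hK hL y₀ t).mono (F.le t) le_rfl
  have hX : Measurable (S.X (t + 1)) := (S.adapted_X t).mono (F.le _) le_rfl
  filter_upwards [condLExp_hatIntegrand_ae_eq hK hL hi y₀ t n,
    ae_eq_zero_of_condLExp_eq_zero (P := P) (F.le t) (f := fun ω => (S.X (t + 1) ω n : ℝ≥0∞)
      / ((S.realizedZeta K L y₀ t ω * S.ρ (t + 1) ω + ∑ k, S.X (t + 1) ω k : ℝ≥0) : ℝ≥0∞))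
      (by fun_prop)] with ω h_eq h_zero hω
  exact ENNReal.coe_eq_zero.1 ((ENNReal.div_eq_zero_iff.1
    (h_zero (h_eq.trans (by rw [hω, ENNReal.coe_zero])))).resolve_right ENNReal.coe_ne_top)

theorem condLExp_realizedGrowthDefect_le_one (hK : S.IsRegularConditionalLaw K)
    (hL : ∀ m, IsStrategy F (L m)) (hi : L i = S.hatRule K) (y₀ : Fin M → ℝ≥0) (t : ℕ) :
    P⁻[fun ω => (S.realizedGrowthDefect K L y₀ i t ω : ℝ≥0∞) | F t] ≤ᵐ[P] 1 := by
  filter_upwards [hK.condLExp_ae_eq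
    (φ := fun ω => (S.ρ (t + 1) ω, realizedProportions L y₀ t ω,
      fun k => S.wealth L y₀ t k ω, S.realizedZeta K L y₀ t ω))
    (f := fun p => (growthDefect p.1.1 p.2 p.1.2.1 p.1.2.2.1 i p.1.2.2.2 : ℝ≥0∞))
    ((S.predictable_ρ t).prodMk ((measurable_realizedProportions hL y₀ t).prodMk
      ((S.measurable_wealth hL y₀ t).prodMk (measurable_realizedZeta hK hL y₀ t))))
    (measurable_growthDefect i (by fun_prop) (by fun_prop) (by fun_prop) (by fun_prop)
      (by fun_prop)).coe_nnreal_ennreal] with ω hω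
  refine hω.trans_le ?_
  exact lintegral_growthDefect_le _ _ (bankIntegral_zeta_le _ _ _)
    (realizedProportions_hatRule hi y₀ t ω)

theorem ae_wealth_pos_of_eq_hatRule (hK : S.IsRegularConditionalLaw K)
    (hL : ∀ m, IsStrategy F (L m)) (hi : L i = S.hatRule K) {y₀ : Fin M → ℝ≥0}
    (hy₀ : 0 < y₀ i) (t : ℕ) : ∀ᵐ ω ∂P, 0 < S.wealth L y₀ t i ω := by
  induction t with
  | zero => exact ae_of_all _ fun _ => hy₀
  | succ t ih =>
    filter_upwards [ih, ae_pos_realizedZeta_mul_add hK hL y₀ t,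
      ae_eq_zero_of_realizedProportions_eq_zero hK hL hi y₀ t] with ω hY hW hX
    rw [wealth_succ]
    exact wealthStep_pos hY (hW (hY.trans_le (S.wealth_le_sum L y₀ t i ω)))
      (zeta_add_mul_sum_realizedProportions_le hi y₀ t ω) hX

theorem ae_log_relWealth_add_le (hK : S.IsRegularConditionalLaw K)
    (hL : ∀ m, IsStrategy F (L m)) (hi : L i = S.hatRule K) {y₀ : Fin M → ℝ≥0}
    (hy₀ : 0 < y₀ i) (t : ℕ) :
    ∀ᵐ ω ∂P, Real.log (S.relWealth L y₀ t i ω)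
      + (1 - (S.realizedGrowthDefect K L y₀ i t ω : ℝ))
        ≤ Real.log (S.relWealth L y₀ (t + 1) i ω) := by
  filter_upwards [ae_wealth_pos_of_eq_hatRule hK hL hi hy₀ t,
    ae_pos_realizedZeta_mul_add hK hL y₀ t,
    ae_eq_zero_of_realizedProportions_eq_zero hK hL hi y₀ t] with ω hY hW hX
  simp only [relWealth, wealth_succ]
  exact log_add_one_sub_growthDefect_le hY (hW (hY.trans_le (S.wealth_le_sum L y₀ t i ω)))
    (zeta_add_mul_sum_realizedProportions_le hi y₀ t ω) hX

theorem isRelativeGrowthOptimal_hatRule (hK : S.IsRegularConditionalLaw K) (i : Fin M) :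
    S.IsRelativeGrowthOptimal i (S.hatRule K) := by
  refine ⟨isStrategy_hatRule hK, fun y₀ L hy₀ hi hL_ne => ?_⟩
  have hL : ∀ m, IsStrategy F (L m) := fun m => by
    rcases eq_or_ne m i with rfl | hm
    exacts [hi ▸ isStrategy_hatRule hK, hL_ne m hm]
  refine ⟨fun t => ?_, submartingale_of_add_le
    (v := fun t ω => 1 - (S.realizedGrowthDefect K L y₀ i t ω : ℝ))
    (fun t => ((S.measurable_relWealth hL y₀ t i).coe_nnreal_real.log).stronglyMeasurable)
    (fun t => ae_of_all _ fun ω => Real.log_nonpos NNReal.zero_le_coe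
      (by exact_mod_cast S.relWealth_le_one L y₀ t i ω))
    (integrable_const (Real.log ((y₀ i / ∑ k, y₀ k : ℝ≥0) : ℝ)))
    (fun t => (integrable_const 1).sub (integrable_of_condLExp_le_one (F.le t)
      (measurable_realizedGrowthDefect hK hL y₀ i t)
      (condLExp_realizedGrowthDefect_le_one hK hL hi y₀ t)))
    (fun t => condExp_one_sub_nonneg (F.le t) (measurable_realizedGrowthDefect hK hL y₀ i t)
      (condLExp_realizedGrowthDefect_le_one hK hL hi y₀ t))
    (fun t => ae_log_relWealth_add_le hK hL hi (hy₀ i) t)⟩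
  filter_upwards [ae_wealth_pos_of_eq_hatRule hK hL hi (hy₀ i) t] with ω hω
  exact div_pos hω (hω.trans_le (S.wealth_le_sum L y₀ t i ω))

end Market

end HatRule

section ExtendedConditionalExpectation

variable {Ω : Type*} {m mΩ : MeasurableSpace Ω} {P : Measure Ω}

theorem condLExp_ofReal_neg_le [IsFiniteMeasure P] {w : Ω → ℝ} (hw : Integrable w P)
    (hw_nonneg : 0 ≤ᵐ[P] P[w | m]) :
    P⁻[fun ω => ENNReal.ofReal (-w ω) | m] ≤ᵐ[P] P⁻[fun ω => ENNReal.ofReal (w ω) | m] := by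
  have h_max : ∀ x : ℝ, ENNReal.ofReal (max x 0) = ENNReal.ofReal x := fun x => by
    simp [ENNReal.ofReal_max]
  have h_pos := condLExp_ofReal m hw.pos_part (ae_of_all _ fun ω => le_max_right (w ω) 0)
  have h_neg := condLExp_ofReal m hw.neg_part (ae_of_all _ fun ω => le_max_right (-w ω) 0)
  simp only [h_max] at h_pos h_neg
  have h_sub : (fun ω => max (w ω) 0) - (fun ω => max (-w ω) 0) = w :=
    funext fun ω => max_zero_sub_max_neg_zero_eq_self (w ω)
  have h_condExp := condExp_sub hw.pos_part hw.neg_part m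
  rw [h_sub] at h_condExp
  filter_upwards [h_pos, h_neg, h_condExp, hw_nonneg] with ω h_pos h_neg h_condExp hω
  rw [h_pos, h_neg]
  exact ENNReal.ofReal_le_ofReal (sub_nonneg.1 (hω.trans_eq h_condExp))

theorem condLExp_ofReal_mul_neg_le [IsFiniteMeasure P] (hm : m ≤ mΩ) {c : Ω → ℝ≥0} {w : Ω → ℝ}
    (hc : Measurable[m] c) (hwm : Measurable w) (hw : Integrable w P)
    (hw_nonneg : 0 ≤ᵐ[P] P[w | m]) :
    ∀ᵐ ω ∂P, P⁻[fun ω => ENNReal.ofReal (-(c ω * w ω)) | m] ω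
        ≤ P⁻[fun ω => ENNReal.ofReal (c ω * w ω) | m] ω ∧
      P⁻[fun ω => ENNReal.ofReal (c ω * w ω) | m] ω < ∞ := by
  have hc' : Measurable[m] fun ω => (c ω : ℝ≥0∞) := hc.coe_nnreal_ennreal
  simp only [← mul_neg, ENNReal.ofReal_mul NNReal.zero_le_coe, ENNReal.ofReal_coe_nnreal]
  filter_upwards [condLExp_mul_of_measurable_left (P := P) hm hc' hwm.ennreal_ofReal,
    condLExp_mul_of_measurable_left (P := P) hm hc' hwm.neg.ennreal_ofReal,
    condLExp_ofReal_neg_le hw hw_nonneg,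
    condLExp_lt_top (mΩ := m) hw.lintegral_lt_top.ne] with ω h_pos h_neg h_le h_lt_top
  rw [h_pos, show P⁻[fun ω => c ω * ENNReal.ofReal (-w ω) | m] ω = _ from h_neg]
  exact ⟨mul_le_mul_right h_le _, ENNReal.mul_lt_top ENNReal.coe_lt_top h_lt_top⟩

theorem toENNReal_add_ofReal_add_toENNReal_neg_le {f g : EReal} {v : ℝ} (h : f + v ≤ g) :
    f.toENNReal + ENNReal.ofReal v + (-g).toENNReal
      ≤ g.toENNReal + (-f).toENNReal + ENNReal.ofReal (-v) := by
  induction f with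
  | bot => simp
  | top =>
    obtain rfl : g = ⊤ := top_le_iff.1 (by simpa using h)
    simp
  | coe f =>
    induction g with
    | bot => exact absurd h (by simp)
    | top => simp
    | coe g =>
      have h' : f + v ≤ g := by exact_mod_cast h
      rw [← EReal.coe_neg, ← EReal.coe_neg]
      simp only [EReal.real_coe_toENNReal]
      rw [← ENNReal.toReal_le_toReal (by finiteness) (by finiteness)]
      repeat rw [ENNReal.toReal_add (by finiteness) (by finiteness)]
      simp only [ENNReal.toReal_ofReal']
      linarith [max_zero_sub_max_neg_zero_eq_self f, max_zero_sub_max_neg_zero_eq_self g,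
        max_zero_sub_max_neg_zero_eq_self v]

theorem toENNReal_neg_le_add_ofReal_neg {f g : EReal} {v : ℝ} (h : f + v ≤ g) :
    (-g).toENNReal ≤ (-f).toENNReal + ENNReal.ofReal (-v) := by
  rw [← EReal.real_coe_toENNReal, EReal.coe_neg]
  refine (EReal.toENNReal_le_toENNReal (EReal.neg_le_neg_iff.2 h)).trans ?_
  rw [EReal.neg_add (by simp) (by simp), sub_eq_add_neg]
  exact EReal.toENNReal_add_le

theorem ereal_coe_sub_coe_le_coe_sub_coe {a a' b b' v v' : ℝ≥0∞} (hv : v' ≤ v) (hv_top : v < ∞)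
    (h : a + v + b' ≤ b + a' + v') (h' : b' ≤ a' + v') :
    (a : EReal) - (a' : EReal) ≤ (b : EReal) - (b' : EReal) := by
  have hv'_top : v' ≠ ∞ := (hv.trans_lt hv_top).ne
  have h_add : a + b' ≤ b + a' := by
    refine (ENNReal.add_le_add_iff_right hv'_top).1 (le_trans ?_ h)
    calc a + b' + v' ≤ a + b' + v := by gcongr
      _ = a + v + b' := add_right_comm a b' v
  rcases eq_or_ne a' ∞ with rfl | ha'
  · simp
  have hb' : b' ≠ ∞ := ne_top_of_le_ne_top (ENNReal.add_ne_top.2 ⟨ha', hv'_top⟩) h'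
  lift a' to ℝ≥0 using ha'
  lift b' to ℝ≥0 using hb'
  refine EReal.sub_le_of_le_add ?_
  rw [sub_eq_add_neg, add_right_comm, ← sub_eq_add_neg]
  refine (EReal.le_sub_iff_add_le (by simp) (by simp)).2 ?_
  exact_mod_cast h_add

theorem extCondExp_le_of_add_mul_le [IsFiniteMeasure P] (hm : m ≤ mΩ) {f g : Ω → EReal}
    {c : Ω → ℝ≥0} {w : Ω → ℝ} (hf : Measurable f) (hg : Measurable g) (hc : Measurable[m] c)
    (hwm : Measurable w) (hw : Integrable w P) (hw_nonneg : 0 ≤ᵐ[P] P[w | m])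
    (hfg : ∀ᵐ ω ∂P, f ω + ((c ω * w ω : ℝ) : EReal) ≤ g ω) :
    extCondExp P m f ≤ᵐ[P] extCondExp P m g := by
  let v : Ω → ℝ := fun ω => c ω * w ω
  have hv : Measurable v := (hc.mono hm le_rfl).coe_nnreal_real.mul hwm
  have hfp : Measurable fun ω => (f ω).toENNReal := hf.ereal_toENNReal
  have hfn : Measurable fun ω => (-f ω).toENNReal := hf.neg.ereal_toENNReal
  have hgp : Measurable fun ω => (g ω).toENNReal := hg.ereal_toENNReal
  have hvp : Measurable fun ω => ENNReal.ofReal (v ω) := hv.ennreal_ofReal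
  filter_upwards [condLExp_ofReal_mul_neg_le hm hc hwm hw hw_nonneg,
    condLExp_mono (mΩ := m) (hfg.mono fun ω => toENNReal_add_ofReal_add_toENNReal_neg_le),
    condLExp_mono (mΩ := m) (hfg.mono fun ω => toENNReal_neg_le_add_ofReal_neg),
    condLExp_add_left (mΩ := m) (fun ω => (-g ω).toENNReal) (hfp.add hvp).aemeasurable,
    condLExp_add_left (mΩ := m) (fun ω => ENNReal.ofReal (v ω)) hfp.aemeasurable,
    condLExp_add_left (mΩ := m) (fun ω => ENNReal.ofReal (-v ω)) (hgp.add hfn).aemeasurable,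
    condLExp_add_left (mΩ := m) (fun ω => (-f ω).toENNReal) hgp.aemeasurable,
    condLExp_add_left (mΩ := m) (fun ω => ENNReal.ofReal (-v ω)) hfn.aemeasurable]
    with ω h_mean h_le h_neg_le h_lhs h_fv h_rhs h_gf h_bound
  refine ereal_coe_sub_coe_le_coe_sub_coe h_mean.1 h_mean.2 ?_ (h_neg_le.trans_eq h_bound)
  simp only [Pi.add_apply] at h_lhs h_fv h_rhs h_gf
  rw [← h_fv, ← h_gf, ← h_lhs, ← h_rhs]
  exact h_le

theorem log_div_add_mul_log_sub_log_le {p q p' q' : ℝ} (hp : 0 < p) (hq : 0 < q) (hp' : 0 < p')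
    (hq' : 0 < q') :
    Real.log (q' / q) + (p + q) / q * (Real.log (p' / (p' + q')) - Real.log (p / (p + q)))
      ≤ Real.log (p' / p) := by
  have hs : 0 < p + q := add_pos hp hq
  have hs' : 0 < p' + q' := add_pos hp' hq'
  have h_concave : p / (p + q) * Real.log (p' / p) + q / (p + q) * Real.log (q' / q)
      ≤ Real.log ((p' + q') / (p + q)) := by
    have h_mean : p / (p + q) * (p' / p) + q / (p + q) * (q' / q) = (p' + q') / (p + q) := by
      field_simp
    rw [← h_mean]
    exact strictConcaveOn_log_Ioi.concaveOn.2 (div_pos hp' hp) (div_pos hq' hq)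
      (div_pos hp hs).le (div_pos hq hs).le (by field_simp)
  have h_ratio : Real.log (p' / (p' + q')) - Real.log (p / (p + q))
      = Real.log (p' / p) - Real.log ((p' + q') / (p + q)) := by
    rw [Real.log_div hp'.ne' hs'.ne', Real.log_div hp.ne' hs.ne', Real.log_div hp'.ne' hp.ne',
      Real.log_div hs'.ne' hs.ne']
    ring
  rw [h_ratio, div_mul_eq_mul_div, ← le_sub_iff_add_le', div_le_iff₀ hq]
  rw [div_mul_eq_mul_div, div_mul_eq_mul_div, ← add_div, div_le_iff₀ hs] at h_concave
  linarith

theorem ennreal_log_div_add_mul_log_sub_log_le {p q p' q' : ℝ≥0} (hp : 0 < p) (hp' : 0 < p') :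
    ENNReal.log (q' / q : ℝ≥0) + ((((p + q) / q : ℝ≥0) * (Real.log (p' / (p' + q') : ℝ≥0)
      - Real.log (p / (p + q) : ℝ≥0)) : ℝ) : EReal) ≤ ENNReal.log (p' / p : ℝ≥0) := by
  rcases eq_or_ne (q' / q) 0 with h | h
  · simp [h]
  obtain ⟨hq', hq⟩ := div_ne_zero_iff.1 h
  rw [ENNReal.log_of_nnreal h, ENNReal.log_of_nnreal (div_pos hp' hp).ne', ← EReal.coe_add,
    EReal.coe_le_coe_iff]
  push_cast
  exact log_div_add_mul_log_sub_log_le (NNReal.coe_pos.2 hp) (NNReal.coe_pos.2 (pos_of_ne_zero hq))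
    (NNReal.coe_pos.2 hp') (NNReal.coe_pos.2 (pos_of_ne_zero hq'))

theorem extCondExp_log_div_le [IsFiniteMeasure P] (hm : m ≤ mΩ) {p q p' q' : Ω → ℝ≥0}
    (hp : Measurable[m] p) (hq : Measurable[m] q) (hp' : Measurable p') (hq' : Measurable q')
    (hp_pos : ∀ᵐ ω ∂P, 0 < p ω) (hp'_pos : ∀ᵐ ω ∂P, 0 < p' ω)
    (hint : Integrable (fun ω => Real.log (p' ω / (p' ω + q' ω) : ℝ≥0)
      - Real.log (p ω / (p ω + q ω) : ℝ≥0)) P)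
    (h_nonneg : 0 ≤ᵐ[P] P[fun ω => Real.log (p' ω / (p' ω + q' ω) : ℝ≥0)
      - Real.log (p ω / (p ω + q ω) : ℝ≥0) | m]) :
    extCondExp P m (fun ω => ENNReal.log (q' ω / q ω : ℝ≥0))
      ≤ᵐ[P] extCondExp P m (fun ω => ENNReal.log (p' ω / p ω : ℝ≥0)) := by
  have hp₀ : Measurable p := hp.mono hm le_rfl
  have hq₀ : Measurable q := hq.mono hm le_rfl
  refine extCondExp_le_of_add_mul_le hm (c := fun ω => (p ω + q ω) / q ω) (by fun_prop)
    (by fun_prop) ((hp.add hq).div hq) (by fun_prop) hint h_nonneg ?_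
  filter_upwards [hp_pos, hp'_pos] with ω hω hω'
  exact ennreal_log_div_add_mul_log_sub_log_le hω hω'

end ExtendedConditionalExpectation

section LogarithmicGrowth

theorem limsup_log_div_le {u v : ℕ → ℝ≥0} {b : ℝ≥0} (hb : b ≠ 0)
    (h : ∀ᶠ t in atTop, u t ≤ b * v t) :
    limsup (fun t : ℕ => ENNReal.log (u t : ℝ≥0∞) / (t : EReal)) atTop
      ≤ limsup (fun t : ℕ => ENNReal.log (v t : ℝ≥0∞) / (t : EReal)) atTop := by
  have h_lim : Tendsto (fun t : ℕ => ((Real.log b / t : ℝ) : EReal)) atTop (nhds 0) := by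
    exact_mod_cast (continuous_coe_real_ereal.tendsto 0).comp
      (tendsto_const_div_atTop_nhds_zero_nat (Real.log b))
  have h_le : ∀ᶠ t : ℕ in atTop, ENNReal.log (u t : ℝ≥0∞) / (t : EReal)
      ≤ ((Real.log b / t : ℝ) : EReal) + ENNReal.log (v t : ℝ≥0∞) / (t : EReal) := by
    filter_upwards [h] with t ht
    have h_log : ENNReal.log (u t : ℝ≥0∞) ≤ (Real.log b : EReal) + ENNReal.log (v t : ℝ≥0∞) := by
      rw [← ENNReal.log_of_nnreal hb, ← ENNReal.log_mul_add]
      exact ENNReal.log_le_log (by exact_mod_cast ht)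
    have ht_nonneg : (0 : EReal) ≤ (t : EReal) := by positivity
    refine (EReal.div_le_div_right_of_nonneg ht_nonneg h_log).trans_eq ?_
    rw [EReal.add_div_of_nonneg_right ht_nonneg, EReal.coe_div, EReal.coe_natCast]
  calc _ ≤ limsup (fun t : ℕ => ((Real.log b / t : ℝ) : EReal)
          + ENNReal.log (v t : ℝ≥0∞) / (t : EReal)) atTop := limsup_le_limsup h_le
    _ ≤ limsup (fun t : ℕ => ((Real.log b / t : ℝ) : EReal)) atTop
        + limsup (fun t : ℕ => ENNReal.log (v t : ℝ≥0∞) / (t : EReal)) atTop :=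
        EReal.limsup_add_le (by simp [h_lim.limsup_eq]) (by simp [h_lim.limsup_eq])
    _ = limsup (fun t : ℕ => ENNReal.log (v t : ℝ≥0∞) / (t : EReal)) atTop := by
        rw [h_lim.limsup_eq, zero_add]

theorem exists_forall_one_le_mul_of_tendsto_log {r : ℕ → ℝ≥0} {a : ℝ} (hr : ∀ t, 0 < r t)
    (h : Tendsto (fun t => Real.log (r t)) atTop (nhds a)) : ∃ b ≠ 0, ∀ t, 1 ≤ b * r t := by
  obtain ⟨B, hB⟩ := h.bddBelow_range
  refine ⟨(Real.exp (-B)).toNNReal, (Real.toNNReal_pos.2 (Real.exp_pos _)).ne', fun t => ?_⟩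
  rw [← NNReal.coe_le_coe, NNReal.coe_mul, Real.coe_toNNReal _ (Real.exp_pos _).le,
    ← Real.exp_log (NNReal.coe_pos.2 (hr t)), ← Real.exp_add, NNReal.coe_one]
  exact Real.one_le_exp (by linarith [hB ⟨t, rfl⟩])

theorem toENNReal_log_eq_ofReal_posLog (x : ℝ≥0) :
    (ENNReal.log x).toENNReal = ENNReal.ofReal (Real.posLog x) := by
  rcases eq_or_ne x 0 with rfl | hx
  · simp
  · simp [ENNReal.log_of_nnreal hx, Real.posLog_def, ENNReal.ofReal_max]

theorem toENNReal_log_lt_top (x : ℝ≥0) : (ENNReal.log x).toENNReal < ∞ := by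
  rw [toENNReal_log_eq_ofReal_posLog]
  exact ENNReal.ofReal_lt_top

theorem toENNReal_log_mono {x y : ℝ≥0} (h : x ≤ y) :
    (ENNReal.log x).toENNReal ≤ (ENNReal.log y).toENNReal :=
  EReal.toENNReal_le_toENNReal (ENNReal.log_le_log (ENNReal.coe_le_coe.2 h))

theorem toENNReal_log_mul_le (x y : ℝ≥0) :
    (ENNReal.log (x * y : ℝ≥0)).toENNReal
      ≤ (ENNReal.log x).toENNReal + (ENNReal.log y).toENNReal := by
  rw [ENNReal.coe_mul, ENNReal.log_mul_add]
  exact EReal.toENNReal_add_le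

theorem toENNReal_log_add_le (x y : ℝ≥0) :
    (ENNReal.log (x + y : ℝ≥0)).toENNReal
      ≤ ENNReal.ofReal (Real.log 2) + (ENNReal.log x).toENNReal + (ENNReal.log y).toENNReal := by
  simp only [toENNReal_log_eq_ofReal_posLog, NNReal.coe_add]
  refine (ENNReal.ofReal_le_ofReal Real.posLog_add).trans ?_
  exact ENNReal.ofReal_add_le.trans (add_le_add_left ENNReal.ofReal_add_le _)

theorem toENNReal_log_le_self (x : ℝ≥0) : (ENNReal.log x).toENNReal ≤ x := by
  rw [toENNReal_log_eq_ofReal_posLog, ← ENNReal.ofReal_coe_nnreal]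
  exact ENNReal.ofReal_le_ofReal (max_le NNReal.zero_le_coe (Real.log_le_self NNReal.zero_le_coe))

theorem lintegral_toENNReal_log_lt_top {Ω : Type*} [MeasurableSpace Ω] {P : Measure Ω}
    {U : Ω → ℝ≥0} (hU : Integrable (fun ω => (U ω : ℝ)) P) :
    ∫⁻ ω, (ENNReal.log (U ω)).toENNReal ∂P < ∞ := by
  refine (lintegral_mono fun ω => toENNReal_log_le_self (U ω)).trans_lt ?_
  simpa only [ENNReal.ofReal_coe_nnreal] using hU.lintegral_lt_top

end LogarithmicGrowth

section Growth

namespace Market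

variable {Ω : Type*} [mΩ : MeasurableSpace Ω] {P : Measure Ω} {F : Filtration ℕ mΩ} {M N : ℕ}
  {S : Market P F N} {L : Fin M → Rule Ω M N} {y₀ : Fin M → ℝ≥0} {i : Fin M}

theorem wealth_pos_of_relWealth_pos {t : ℕ} {ω : Ω} (h : 0 < S.relWealth L y₀ t i ω) :
    0 < S.wealth L y₀ t i ω :=
  pos_of_ne_zero (div_ne_zero_iff.1 h.ne').1

variable [IsFiniteMeasure P]

theorem limsup_log_wealth_le (hpos : ∀ t, ∀ᵐ ω ∂P, 0 < S.relWealth L y₀ t i ω)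
    (hsub : Submartingale (fun t ω => Real.log (S.relWealth L y₀ t i ω)) F P) (m : Fin M) :
    ∀ᵐ ω ∂P,
      limsup (fun t : ℕ => ENNReal.log (S.wealth L y₀ t m ω : ℝ≥0∞) / (t : EReal)) atTop
        ≤ limsup (fun t : ℕ => ENNReal.log (S.wealth L y₀ t i ω : ℝ≥0∞) / (t : EReal)) atTop := by
  have h_nonpos : ∀ t, (fun ω => Real.log (S.relWealth L y₀ t i ω)) ≤ᵐ[P] 0 := fun t =>
    ae_of_all _ fun ω => Real.log_nonpos NNReal.zero_le_coe
      (by exact_mod_cast S.relWealth_le_one L y₀ t i ω)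
  filter_upwards [ae_all_iff.2 hpos, ae_exists_tendsto_of_submartingale_nonpos hsub h_nonpos]
    with ω hω ⟨a, ha⟩
  obtain ⟨b, hb, h_one_le⟩ := exists_forall_one_le_mul_of_tendsto_log hω ha
  refine limsup_log_div_le hb (Eventually.of_forall fun t => ?_)
  have h_sum : ∑ k, S.wealth L y₀ t k ω ≠ 0 := (div_ne_zero_iff.1 (hω t).ne').2
  calc S.wealth L y₀ t m ω ≤ 1 * ∑ k, S.wealth L y₀ t k ω := by
        rw [one_mul]
        exact S.wealth_le_sum L y₀ t m ω
    _ ≤ b * S.relWealth L y₀ t i ω * ∑ k, S.wealth L y₀ t k ω := by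
        gcongr
        exact h_one_le t
    _ = b * S.wealth L y₀ t i ω := by rw [mul_assoc, relWealth, div_mul_cancel₀ _ h_sum]

theorem extCondExp_logReturn_le {L : Fin 2 → Rule Ω 2 N} {y₀ : Fin 2 → ℝ≥0} {i : Fin 2}
    (hL : ∀ m, IsStrategy F (L m)) (hpos : ∀ t, ∀ᵐ ω ∂P, 0 < S.relWealth L y₀ t i ω)
    (hsub : Submartingale (fun t ω => Real.log (S.relWealth L y₀ t i ω)) F P)
    (m : Fin 2) (s t : ℕ) :
    extCondExp P (F s) (S.logReturn L y₀ s t m)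
      ≤ᵐ[P] extCondExp P (F s) (S.logReturn L y₀ s t i) := by
  rcases eq_or_ne m i with rfl | hmi
  · exact EventuallyLE.rfl
  have h_meas : ∀ u k, Measurable (S.wealth L y₀ u k) := fun u k =>
    (S.measurable_wealth_apply hL y₀ u k).mono (F.le u) le_rfl
  have h_wealth_pos : ∀ u, ∀ᵐ ω ∂P, 0 < S.wealth L y₀ u i ω := fun u =>
    (hpos u).mono fun ω => wealth_pos_of_relWealth_pos
  have h_relWealth : ∀ u ω, S.relWealth L y₀ u i ω
      = S.wealth L y₀ u i ω / (S.wealth L y₀ u i ω + S.wealth L y₀ u m ω) := fun u ω => by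
    rw [relWealth, Fintype.sum_eq_add i m hmi.symm fun k hk => by omega]
  have h_int := (hsub.integrable (s + t)).sub (hsub.integrable s)
  have h_nonneg := hsub.condExp_sub_nonneg (Nat.le_add_right s t)
  simp only [h_relWealth] at h_int h_nonneg
  exact extCondExp_log_div_le (F.le s) (S.measurable_wealth_apply hL y₀ s i)
    (S.measurable_wealth_apply hL y₀ s m) (h_meas (s + t) i) (h_meas (s + t) m)
    (h_wealth_pos s) (h_wealth_pos (s + t)) h_int h_nonneg

theorem lintegral_toENNReal_log_sum_wealth_lt_top (hL : ∀ m, IsStrategy F (L m))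
    (y₀ : Fin M → ℝ≥0)
    (hX : ∀ t, ∫⁻ ω, (ENNReal.log (∑ n, S.X (t + 1) ω n : ℝ≥0)).toENNReal ∂P < ∞)
    (hρ : ∀ t, ∫⁻ ω, (ENNReal.log (S.ρ (t + 1) ω)).toENNReal ∂P < ∞) (t : ℕ) :
    ∫⁻ ω, (ENNReal.log (∑ k, S.wealth L y₀ t k ω : ℝ≥0)).toENNReal ∂P < ∞ := by
  induction t with
  | zero =>
    exact (lintegral_const _).trans_lt
      (ENNReal.mul_lt_top (toENNReal_log_lt_top (∑ k, y₀ k)) (measure_lt_top P _))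
  | succ t ih =>
    have hρm : Measurable (S.ρ (t + 1)) := (S.predictable_ρ t).mono (F.le t) le_rfl
    have hCm : Measurable fun ω => ∑ k, S.wealth L y₀ t k ω :=
      (S.measurable_sum_wealth hL y₀ t).mono (F.le t) le_rfl
    calc ∫⁻ ω, (ENNReal.log (∑ k, S.wealth L y₀ (t + 1) k ω : ℝ≥0)).toENNReal ∂P
        ≤ ∫⁻ ω, (ENNReal.ofReal (Real.log 2) + ((ENNReal.log (S.ρ (t + 1) ω)).toENNReal
            + (ENNReal.log (∑ k, S.wealth L y₀ t k ω : ℝ≥0)).toENNReal)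
            + (ENNReal.log (∑ n, S.X (t + 1) ω n : ℝ≥0)).toENNReal) ∂P := by
          refine lintegral_mono fun ω => ?_
          simp only [wealth_succ]
          refine (toENNReal_log_mono (sum_wealthStep_le_mul_sum_add _ _ _ _)).trans
            ((toENNReal_log_add_le _ _).trans ?_)
          gcongr
          exact toENNReal_log_mul_le _ _
      _ = ∫⁻ _, ENNReal.ofReal (Real.log 2) ∂P
            + (∫⁻ ω, (ENNReal.log (S.ρ (t + 1) ω)).toENNReal ∂P
            + ∫⁻ ω, (ENNReal.log (∑ k, S.wealth L y₀ t k ω : ℝ≥0)).toENNReal ∂P)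
            + ∫⁻ ω, (ENNReal.log (∑ n, S.X (t + 1) ω n : ℝ≥0)).toENNReal ∂P := by
          rw [lintegral_add_left (by fun_prop), lintegral_add_left (by fun_prop),
            lintegral_add_left (by fun_prop)]
      _ < ∞ := by
          rw [lintegral_const]
          exact ENNReal.add_lt_top.2 ⟨ENNReal.add_lt_top.2
            ⟨ENNReal.mul_lt_top ENNReal.ofReal_lt_top (measure_lt_top P _),
              ENNReal.add_lt_top.2 ⟨hρ t, ih⟩⟩, hX t⟩

theorem ae_condLExp_logReturn_lt_top (hL : ∀ m, IsStrategy F (L m)) (y₀ : Fin M → ℝ≥0)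
    (hX : ∀ t, ∫⁻ ω, (ENNReal.log (∑ n, S.X (t + 1) ω n : ℝ≥0)).toENNReal ∂P < ∞)
    (hρ : ∀ t, ∫⁻ ω, (ENNReal.log (S.ρ (t + 1) ω)).toENNReal ∂P < ∞) (m : Fin M) (s t : ℕ) :
    ∀ᵐ ω ∂P, P⁻[fun ω' => (S.logReturn L y₀ s t m ω').toENNReal | F s] ω < ∞ := by
  let u : Ω → ℝ≥0∞ := fun ω => (ENNReal.log (∑ k, S.wealth L y₀ (s + t) k ω : ℝ≥0)).toENNReal
  let v : Ω → ℝ≥0∞ := fun ω => (ENNReal.log ((S.wealth L y₀ s m ω)⁻¹ : ℝ≥0)).toENNReal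
  have hu : Measurable u := ((S.measurable_sum_wealth hL y₀ (s + t)).mono
    (F.le _) le_rfl).coe_nnreal_ennreal.ennreal_log.ereal_toENNReal
  have hv : Measurable[F s] v :=
    (S.measurable_wealth_apply hL y₀ s m).inv.coe_nnreal_ennreal.ennreal_log.ereal_toENNReal
  have h_le : ∀ ω, (S.logReturn L y₀ s t m ω).toENNReal ≤ (u + v) ω := fun ω => by
    rw [logReturn, div_eq_mul_inv]
    exact (toENNReal_log_mul_le _ _).trans
      (add_le_add_left (toENNReal_log_mono (S.wealth_le_sum L y₀ (s + t) m ω)) _)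
  filter_upwards [condLExp_mono (mΩ := F s) (ae_of_all P h_le),
    condLExp_add_left (mΩ := F s) v hu.aemeasurable,
    condLExp_lt_top (mΩ := F s)
      (lintegral_toENNReal_log_sum_wealth_lt_top hL y₀ hX hρ (s + t)).ne] with ω h_mono h_add hω
  refine h_mono.trans_lt ?_
  rw [h_add, Pi.add_apply, condLExp_eq_self (F.le s) P hv]
  exact ENNReal.add_lt_top.2 ⟨hω, toENNReal_log_lt_top _⟩

end Market

end Growth

theorem theorem3_general {Ω : Type*} [mΩ : MeasurableSpace Ω] (P : Measure Ω) [IsFiniteMeasure P]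
    (F : Filtration ℕ mΩ) {M N : ℕ} (S : Market P F N)
    (K : ℕ → Ω → ProbabilityMeasure (Fin N → ℝ≥0)) (hK : S.IsRegularConditionalLaw K)
    (i : Fin M) (L : Fin M → Rule Ω M N)
    (hi : L i = S.hatRule K ∨ S.IsRelativeGrowthOptimal i (L i))
    (hL : ∀ m, m ≠ i → IsStrategy F (L m))
    (y₀ : Fin M → ℝ≥0) (hy₀ : ∀ m, 0 < y₀ m) :
    (∀ m, ∀ᵐ ω ∂P,
      limsup (fun t : ℕ => ENNReal.log (S.wealth L y₀ t m ω : ℝ≥0∞) / (t : EReal)) atTop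
        ≤ limsup (fun t : ℕ => ENNReal.log (S.wealth L y₀ t i ω : ℝ≥0∞) / (t : EReal)) atTop) ∧
    (M = 2 → ∀ m, ∀ s t : ℕ, ∀ᵐ ω ∂P,
      extCondExp P (F s) (S.logReturn L y₀ s t m) ω
        ≤ extCondExp P (F s) (S.logReturn L y₀ s t i) ω) ∧
    ((∀ t, ∫⁻ ω, (ENNReal.log (∑ n, S.X (t + 1) ω n : ℝ≥0)).toENNReal ∂P < ∞) →
      (∀ t, ∫⁻ ω, (ENNReal.log (S.ρ (t + 1) ω)).toENNReal ∂P < ∞) →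
      ∀ m, ∀ s t : ℕ, ∀ᵐ ω ∂P,
        P⁻[fun ω' => (S.logReturn L y₀ s t m ω').toENNReal | F s] ω < ∞) := by
  have hopt : S.IsRelativeGrowthOptimal i (L i) :=
    hi.elim (fun h => h ▸ Market.isRelativeGrowthOptimal_hatRule hK i) id
  have hL' : ∀ m, IsStrategy F (L m) := fun m => by
    rcases eq_or_ne m i with rfl | hm
    exacts [hopt.1, hL m hm]
  obtain ⟨hpos, hsub⟩ := hopt.2 y₀ L hy₀ rfl hL
  refine ⟨Market.limsup_log_wealth_le hpos hsub, ?_, Market.ae_condLExp_logReturn_lt_top hL' y₀⟩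
  rintro rfl
  exact Market.extCondExp_logReturn_le hL' hpos hsub

/-- Investor `i` (called investor 1 in the model) uses the strategy `Λ̂`, or any other relative
growth optimal strategy; the other investors use arbitrary strategies. -/
theorem theorem3 {Ω : Type*} [mΩ : MeasurableSpace Ω] (P : Measure Ω) [IsProbabilityMeasure P]
    (F : Filtration ℕ mΩ) {M N : ℕ} (hM : 2 ≤ M) (hN : 1 ≤ N) (S : Market P F N)
    (K : ℕ → Ω → ProbabilityMeasure (Fin N → ℝ≥0)) (hK : S.IsRegularConditionalLaw K)
    (i : Fin M) (L : Fin M → Rule Ω M N)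
    (hi : L i = S.hatRule K ∨ S.IsRelativeGrowthOptimal i (L i))
    (hL : ∀ m, m ≠ i → IsStrategy F (L m))
    (y₀ : Fin M → ℝ≥0) (hy₀ : ∀ m, 0 < y₀ m) :
    -- asymptotic growth rate
    (∀ m, ∀ᵐ ω ∂P,
      limsup (fun t : ℕ => ENNReal.log (S.wealth L y₀ t m ω : ℝ≥0∞) / (t : EReal)) atTop
        ≤ limsup (fun t : ℕ => ENNReal.log (S.wealth L y₀ t i ω : ℝ≥0∞) / (t : EReal)) atTop) ∧
    -- conditional growth rate over `t` steps, for two investors and integrable payoffs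
    (M = 2 → (∀ t, Integrable (fun ω => ((∑ n, S.X (t + 1) ω n : ℝ≥0) : ℝ)) P) →
      (∀ m, ∀ s t : ℕ, ∀ᵐ ω ∂P,
        extCondExp P (F s) (S.logReturn L y₀ s t m) ω
          ≤ extCondExp P (F s) (S.logReturn L y₀ s t i) ω) ∧
      -- both sides are well defined, with values in `[-∞, ∞)`, as soon as `E ln⁺ ρ_t < ∞`
      ((∀ t, ∫⁻ ω, (ENNReal.log (S.ρ (t + 1) ω : ℝ≥0∞)).toENNReal ∂P < ∞) →
        ∀ m, ∀ s t : ℕ, ∀ᵐ ω ∂P,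
          condLExp (F s) P (fun ω' => (S.logReturn L y₀ s t m ω').toENNReal) ω < ∞)) := by
  obtain ⟨h_limsup, h_extCondExp, h_lt_top⟩ := theorem3_general P F S K hK i L hi hL y₀ hy₀
  exact ⟨h_limsup, fun hM2 hX => ⟨h_extCondExp hM2,
    h_lt_top fun t => lintegral_toENNReal_log_lt_top (hX t)⟩⟩
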